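/- All groups below are finite, $C_n$ is the cyclic group of order $n$, and $H^2(G,\mathbb C^*)$ is taken with trivial action. For a 2-cocycle $f\in Z^2(G,\mathbb C^*)$ the twisted group algebra $\mathbb C^fG$ is the complex algebra with basis $(u_g)_{g\in G}$ and $u_gu_h=f(g,h)u_{gh}$. A class $[f]$ is non-degenerate if $\mathbb C^fG$ is isomorphic to a matrix algebra $M_n(\mathbb C)$, and $G$ is of central type if $H^2(G,\mathbb C^*)$ contains a non-degenerate class. $\mathrm{Aut}(G)$ acts on $H^2(G,\mathbb C^*)$ by $\phi([f])=[f\circ(\phi^{-1}\times\phi^{-1})]$, and this preserves non-degeneracy. For commuting $g,h\in G$ put $\alpha_{[f]}(g,h)=f(h,g)f(g,h)^{-1}$, which depends only on $[f]$. $\mathrm{SL}_2(m)=\mathrm{SL}_2(\mathbb Z/m)$ acts naturally on $C_m\times C_m$. A group is of A-type if all its Sylow subgroups are abelian. There are groups $G$ of central type such that $\mathrm{Aut}(G)$ does not act transitively on the non-degenerate classes in $H^2(G,\mathbb C^*)$; in detail: (0) Let $k$ be an odd prime, let $p_1,p_2,p_3$ be distinct primes with $p_i\equiv\pm1\pmod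 k$, and $m=p_1p_2p_3$. There is an action $\eta:C_k\times C_k=\langle x\rangle\times\langle y\rangle\to \mathrm{SL}_2(m)=\prod_i\mathrm{SL}_2(p_i)$ whose three components have kernels $\langle x\rangle,\langle y\rangle,\langle xy\rangle$ respectively. For every such $\eta$ the group $G=(C_m\times C_m)\rtimes_\eta(C_k\times C_k)$ has cube-free order $(mk)^2$ and is of central type, and $\mathrm{Aut}(G)$ does not act transitively on its non-degenerate classes. More precisely, for every primitive $k$-th root of unity $\xi$ there is a non-degenerate class $[f]$ with $\alpha_{[f]}(x,y)=\xi$, and if $[f],[f']$ are in the same $\mathrm{Aut}(G)$-orbit, then $\alpha_{[f']}(x,y)=\alpha_{[f]}(x,y)^{j^2}$ for some $1\le j\le k-1$. (1) Let $q_1,q_2,q_3$ be primes (possibly $q_1=q_2$) with $q_i\equiv 1\pmod{q_3}$ for $i=1,2$, and let $m_i,n_i\in\mathbb Z$ satisfy $m_in_i\equiv1$, $m_i^{q_3}\equiv1$, $m_i\not\equiv1\pmod{q_i}$. Let $G_i=(C_{q_i}\times C_{q_i})\rtimes_{\eta_i}(\langle\sigma_i\rangle\times\langle\tau_i\rangle)$,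 where $\sigma_i,\tau_i$ have order $q_3$, $\tau_i$ acts trivially, and $\sigma_i$ acts by $x_i\mapsto x_i^{m_i}$, $y_i\mapsto y_i^{n_i}$ on the standard generators $x_i,y_i$ (these actions are well defined). Then $G_1$, $G_2$ and $G=G_1\times G_2$ are of central type, $G$ is of A-type, for every Sylow subgroup $P$ of $G$ the group $\mathrm{Aut}(P)$ acts transitively on the non-degenerate classes in $H^2(P,\mathbb C^*)$, the center of $G$ is $\langle\tau_1,\tau_2\rangle$, and $\mathrm{Aut}(G)$ does not act transitively on the non-degenerate classes in $H^2(G,\mathbb C^*)$. More precisely, put $N=(C_{q_1}\times C_{q_1})\times(C_{q_2}\times C_{q_2})\le G$. Then for every primitive $q_3$-th root of unity $\xi$ there is a non-degenerate class $d\in H^2(N,\mathbb C^*)$ with the following property, and if $q_1\ne q_2$ every non-degenerate class $d\in H^2(N,\mathbb C^*)$ has it: there are non-degenerate $c_1,c_2\in H^2(G,\mathbb C^*)$, both restricting to $d$ on $N$, that lie in different $\mathrm{Aut}(G)$-orbits, such that $\alpha_{c_1}$ is $\xi$ on $(\tau_1,\sigma_1),(\tau_2,\sigma_2)$ and $1$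 on $(\tau_1,\sigma_2),(\tau_2,\sigma_1),(\tau_1,\tau_2),(\sigma_1,\sigma_2)$, while $\alpha_{c_2}$ is $\xi$ on $(\tau_1,\tau_2),(\sigma_1,\sigma_2)$ and $1$ on $(\tau_i,\sigma_j)$ for $1\le i,j\le2$. (2) Let $Q_0=C_4=\langle x\rangle$ act on $A_0=C_2\times C_2=\langle\sigma\rangle\times\langle\tau\rangle$ by letting $x$ interchange $\sigma$ and $\tau$. Put $Q=Q_0\times Q_0$, $A=A_0\times A_0$ with the componentwise action, let $Q$ act on $\check A=\mathrm{Hom}(A,\mathbb C^*)$ by $(q\chi)(a)=\chi(q^{-1}a)$, and let $G=\check A\rtimes Q$. Let $\pi=\pi_0\times\pi_0:Q\to A$ with $\pi_0:1\mapsto1,\ x\mapsto\sigma,\ x^2\mapsto\sigma\tau,\ x^3\mapsto\tau$. Then $\pi$ is a bijective 1-cocycle, $|G|=256$, $G$ is of central type, and $\mathrm{Aut}(G)$ does not act transitively on the non-degenerate classes in $H^2(G,\mathbb C^*)$. More precisely, $c_\pi(\chi q,\chi'q')=(q\chi')(\pi(q))$ is a 2-cocycle of $G$ whose class $[c_\pi]$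 is non-degenerate, has order 2 and restricts trivially to $Q$; there is a class $[c]\in H^2(Q,\mathbb C^*)$ of order 4 with $\alpha_{[c]}((x,1),(1,x))=i$; and $[\beta]=[c_\pi]\cdot\mathrm{inf}([c])$ is non-degenerate, has order 4, and restricts to $[c]$ on $Q$. -/

import Mathlib

open Matrix

noncomputable section

namespace CentralType

/-! ## Second cohomology with values in the trivial module `ℂˣ` -/

section Cohomology

variable {G H : Type} [Group G] [Group H]

/-- The multiplicative group `ℂˣ`, written additively, as a trivial `G`-module. -/
abbrev trivCoeff (G : Type) [Group G] : Rep ℤ G := Rep.trivial ℤ G (Additive ℂˣ)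

/-- The cohomology group `H²(G, ℂˣ)` (written additively). -/
def H2C (G : Type) [Group G] : Type := groupCohomology.H2 (trivCoeff G)

instance (G : Type) [Group G] : AddCommGroup (H2C G) :=
  inferInstanceAs (AddCommGroup (groupCohomology.H2 (trivCoeff G)))

/-- The group `Z²(G, ℂˣ)` of 2-cocycles. -/
abbrev Z2C (G : Type) [Group G] : Type := groupCohomology.cocycles₂ (trivCoeff G)

/-- The value `f(g, h) ∈ ℂˣ` of a 2-cocycle. -/
def cval (f : Z2C G) (g h : G) : ℂˣ := Additive.toMul (f (g, h) : Additive ℂˣ)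

/-- The class `[f] ∈ H²(G, ℂˣ)` of a 2-cocycle. -/
def cls (f : Z2C G) : H2C G := (groupCohomology.H2π (trivCoeff G)).hom f

/-- The map `H²(H, ℂˣ) → H²(G, ℂˣ)`, `[f] ↦ [f ∘ (φ × φ)]`, induced by a homomorphism
`φ : G → H`. It is the restriction when `φ` is the inclusion of a subgroup, and the inflation
when `φ` is the projection onto a quotient. -/
def pull (φ : G →* H) : H2C H →+ H2C G :=
  (groupCohomology.map (A := trivCoeff H) (B := trivCoeff G) φ
    (Rep.ofHom ⟨LinearMap.id, fun _ => rfl⟩) 2).hom.toAddMonoidHom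

/-- `pull φ` is computed on cocycles by composition with `φ × φ`. -/
theorem pull_cls (φ : G →* H) (f : Z2C H) (f' : Z2C G)
    (h : ∀ a b, cval f' a b = cval f (φ a) (φ b)) : pull φ (cls f) = cls f' := by
  have key := groupCohomology.H2π_comp_map_apply (A := trivCoeff H) (B := trivCoeff G) φ
    (Rep.ofHom ⟨LinearMap.id, fun _ => rfl⟩) f
  refine key.trans ?_
  show cls _ = cls f'
  congr 1
  apply groupCohomology.cocycles₂_ext
  intro a b
  exact (Additive.toMul.injective (h a b)).symm

/-- The action of `Aut(G)` on `H²(G, ℂˣ)`: `φ([f]) = [(g₁, g₂) ↦ f(φ⁻¹ g₁, φ⁻¹ g₂)]`. -/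
def autAct (φ : MulAut G) : H2C G →+ H2C G := pull (φ⁻¹ : MulAut G).toMonoidHom

/-- `A` is a twisted group algebra `ℂ^f G`: it has a `ℂ`-basis `(u_g)` indexed by `G` such that
`u_g u_h = f(g, h) u_{gh}`. -/
def IsTwistedGroupAlgebra (f : Z2C G) (A : Type) [Ring A] [Algebra ℂ A] : Prop :=
  ∃ u : Module.Basis G ℂ A, ∀ g h, u g * u h = (cval f g h : ℂ) • u (g * h)

/-- A cocycle `f` is non-degenerate if the twisted group algebra `ℂ^f G` is a complex matrix
algebra. -/
def NondegCocycle (f : Z2C G) : Prop :=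
  ∃ n : ℕ, IsTwistedGroupAlgebra f (Matrix (Fin n) (Fin n) ℂ)

/-- Non-degenerate cohomology classes. -/
def Nondeg (c : H2C G) : Prop := ∃ f : Z2C G, cls f = c ∧ NondegCocycle f

/-- `G` is of central type: it admits a non-degenerate class. -/
def IsCentralType (G : Type) [Group G] : Prop := ∃ c : H2C G, Nondeg c

/-- Two classes lie in the same `Aut(G)`-orbit. -/
def SameOrbit (c c' : H2C G) : Prop := ∃ φ : MulAut G, autAct φ c = c'

/-- `Aut(G)` acts transitively on the set of non-degenerate classes. -/
def AutTransitive (G : Type) [Group G] : Prop :=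
  ∀ c c' : H2C G, Nondeg c → Nondeg c' → SameOrbit c c'

/-- The form `α_f(g, h) = f(h, g) f(h g h⁻¹, h)⁻¹` of a cocycle. -/
def cocycleForm (f : Z2C G) (g h : G) : ℂˣ := cval f h g * (cval f (h * g * h⁻¹) h)⁻¹

theorem cls_surjective : Function.Surjective (cls (G := G)) :=
  (ModuleCat.epi_iff_surjective (groupCohomology.H2π (trivCoeff G))).1
    (inferInstance : CategoryTheory.Epi (groupCohomology.H2π (trivCoeff G)))

/-- The form `α_c(g, h)` of a cohomology class `c`. It is only meaningful for commuting `g`, `h`,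
where by `form_cls` it does not depend on the choice of a representing cocycle. -/
def form (c : H2C G) (g h : G) : ℂˣ := cocycleForm (Function.surjInv cls_surjective c) g h

theorem form_cls (f : Z2C G) {g h : G} (hc : Commute g h) :
    form (cls f) g h = cocycleForm f g h := by
  have e : cls (Function.surjInv cls_surjective (cls f)) = cls f := Function.surjInv_eq _ _
  unfold form
  generalize Function.surjInv cls_surjective (cls f) = f' at e ⊢
  obtain ⟨x, hx⟩ := (groupCohomology.H2π_eq_iff (A := trivCoeff G) f' f).1 e
  let X : G → ℂˣ := fun a => Additive.toMul (x a : Additive ℂˣ)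
  have hx' : ∀ a b : G, cval f' a b = cval f a b *
      (X b * (X (a * b))⁻¹ * X a) := by
    intro a b
    have := congrFun hx (a, b)
    have h2 : (f' (a, b) : Additive ℂˣ) = f (a, b) + (x b - x (a * b) + x a) := by
      rw [add_comm, ← sub_eq_iff_eq_add]
      exact this.symm
    show Additive.toMul (f' (a, b) : Additive ℂˣ) = _
    rw [h2, sub_eq_add_neg]
    rfl
  have hconj : h * g * h⁻¹ = g := by rw [← hc.eq]; simp
  unfold cocycleForm
  rw [hconj, hx' h g, hx' g h, hc.eq]
  generalize X h = a
  generalize X g = b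
  generalize X (h * g) = d
  have : b * d⁻¹ * a = a * d⁻¹ * b := by
    rw [mul_right_comm, mul_comm b a, mul_right_comm]
  rw [this, mul_inv, mul_mul_mul_comm, mul_inv_cancel, mul_one]

end Cohomology

/-- Groups of A-type: all Sylow subgroups are abelian. -/
def IsAType (G : Type) [Group G] : Prop :=
  ∀ p : ℕ, p.Prime → ∀ P : Sylow p G, ∀ a ∈ P, ∀ b ∈ P, a * b = b * a

/-! ## Semidirect products `(C_m × C_m) ⋊ (C_k × C_k)` with action through `SL₂(m)` -/

/-- `C_n × C_n` as the group of column vectors of length two over `ℤ/n`. -/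
abbrev Vec (n : ℕ) : Type := Multiplicative (Fin 2 → ZMod n)

/-- `C_k × C_k` with its two standard generators `CC.x` and `CC.y`. -/
abbrev CC (k : ℕ) : Type := Multiplicative (ZMod k) × Multiplicative (ZMod k)

/-- The first generator of `C_k × C_k`. -/
def CC.x (k : ℕ) : CC k := (Multiplicative.ofAdd 1, 1)

/-- The second generator of `C_k × C_k`. -/
def CC.y (k : ℕ) : CC k := (1, Multiplicative.ofAdd 1)

/-- The natural action of `SL₂(ℤ/m)` on `C_m × C_m`. -/
def slAct (m : ℕ) : SpecialLinearGroup (Fin 2) (ZMod m) →* MulAut (Vec m) where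
  toFun A := AddEquiv.toMultiplicative (SpecialLinearGroup.toLin' A).toAddEquiv
  map_one' := by ext v : 1; simp
  map_mul' A B := by ext v : 1; simp

/-- The group `(C_m × C_m) ⋊_η (C_k × C_k)` for an action `η` via `SL₂(m)`. -/
abbrev SLProd {m k : ℕ} (η : CC k →* SpecialLinearGroup (Fin 2) (ZMod m)) : Type :=
  Vec m ⋊[(slAct m).comp η] CC k

/-- The component `SL₂(∏ p_i) → SL₂(p_i)`. -/
def slComponent (p : Fin 3 → ℕ) (i : Fin 3) :
    SpecialLinearGroup (Fin 2) (ZMod (∏ j, p j)) →* SpecialLinearGroup (Fin 2) (ZMod (p i)) :=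
  SpecialLinearGroup.map
    (ZMod.castHom (Finset.dvd_prod_of_mem p (Finset.mem_univ i)) (ZMod (p i)))

/-- `η : ⟨x, y⟩ → SL₂(p₁p₂p₃) = ∏ SL₂(p_i)` is an action whose three components have the kernels
`⟨x⟩`, `⟨y⟩` and `⟨xy⟩`, respectively. -/
def HasKernels (p : Fin 3 → ℕ) (k : ℕ)
    (η : CC k →* SpecialLinearGroup (Fin 2) (ZMod (∏ j, p j))) : Prop :=
  ((slComponent p 0).comp η).ker = Subgroup.zpowers (CC.x k) ∧
  ((slComponent p 1).comp η).ker = Subgroup.zpowers (CC.y k) ∧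
  ((slComponent p 2).comp η).ker = Subgroup.zpowers (CC.x k * CC.y k)

/-- `η : ⟨σ, τ⟩ → SL₂(q)` is the action in which `τ` acts trivially and `σ` acts by
`x ↦ x ^ a`, `y ↦ y ^ b` on the standard generators `x`, `y` of `C_q × C_q`. -/
def IsDiagAction (q k : ℕ) (a b : ℤ) (η : CC k →* SpecialLinearGroup (Fin 2) (ZMod q)) : Prop :=
  (η (CC.x k) : Matrix (Fin 2) (Fin 2) (ZMod q)) = !![(a : ZMod q), 0; 0, (b : ZMod q)] ∧
  η (CC.y k) = 1

/-! ## The group `Hom(A16, ℂˣ) ⋊ Q16` of order 256 -/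

/-- `Q4 = C₄`. -/
abbrev Q4 : Type := Multiplicative (ZMod 4)

/-- The generator `x` of `Q4`. -/
def Q4.x : Q4 := Multiplicative.ofAdd 1

/-- `V4 = C₂ × C₂ = ⟨σ⟩ × ⟨τ⟩`. -/
abbrev V4 : Type := Multiplicative (ZMod 2) × Multiplicative (ZMod 2)

/-- The action of `Q4` on `V4`: the generator `x` interchanges `σ` and `τ`. -/
def act₀ : Q4 →* MulAut V4 where
  toFun q := (MulEquiv.prodComm : V4 ≃* V4) ^ (Multiplicative.toAdd q).val
  map_one' := rfl
  map_mul' := by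
    have h2 : ((MulEquiv.prodComm : V4 ≃* V4) : MulAut V4) ^ 2 = 1 := rfl
    intro a b
    rw [← pow_add, toAdd_mul, ZMod.val_add,
      pow_eq_pow_mod (_ + _ : ℕ) h2, pow_eq_pow_mod (_ % 4) h2, Nat.mod_mod_of_dvd _ (by norm_num)]

/-- The cocycle `pi₀ : Q4 → V4`, `1 ↦ 1`, `x ↦ σ`, `x² ↦ στ`, `x³ ↦ τ`. -/
def pi₀ (q : Q4) : V4 :=
  ![1, (Multiplicative.ofAdd 1, 1), (Multiplicative.ofAdd 1, Multiplicative.ofAdd 1),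
    (1, Multiplicative.ofAdd 1)] (show Fin 4 from Multiplicative.toAdd q)

/-- `Q16 = Q4 × Q4`. -/
abbrev Q16 : Type := Q4 × Q4

/-- `A16 = V4 × V4`. -/
abbrev A16 : Type := V4 × V4

/-- The componentwise action of `Q16` on `A16`. -/
def act : Q16 →* MulAut A16 where
  toFun q := MulEquiv.prodCongr (act₀ q.1) (act₀ q.2)
  map_one' := by
    ext a : 1
    show (act₀ 1 a.1, act₀ 1 a.2) = a
    simp
  map_mul' q r := by
    ext a : 1
    show (act₀ (q.1 * r.1) a.1, act₀ (q.2 * r.2) a.2) =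
      (act₀ q.1 (act₀ r.1 a.1), act₀ q.2 (act₀ r.2 a.2))
    simp

/-- `piC = pi₀ × pi₀ : Q16 → A16`. -/
def piC (q : Q16) : A16 := (pi₀ q.1, pi₀ q.2)

/-- The character group of `A16`. -/
abbrev A16char : Type := A16 →* ℂˣ

/-- The diagonal action of `Q16` on characters: `(q χ)(a) = χ(q⁻¹ a)`. -/
def charAct : Q16 →* MulAut A16char where
  toFun q :=
    { toFun := fun χ => χ.comp (act q⁻¹).toMonoidHom
      invFun := fun χ => χ.comp (act q).toMonoidHom
      left_inv := fun χ => by ext a : 1; simp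
      right_inv := fun χ => by ext a : 1; simp
      map_mul' := fun χ ψ => rfl }
  map_one' := by ext χ : 1; ext a : 1; simp
  map_mul' q r := by ext χ : 1; ext a : 1; simp

/-- The group `G = Hom(A16, ℂˣ) ⋊ Q16`. -/
abbrev G256 : Type := A16char ⋊[charAct] Q16

/-- The restriction from `G = Hom(A16, ℂˣ) ⋊ Q16` to `Q16`. -/
def resQ : H2C G256 →+ H2C Q16 := pull (SemidirectProduct.inr : Q16 →* G256)

/-- The inflation from `Q16` to `G = Hom(A16, ℂˣ) ⋊ Q16`. -/
def infQ : H2C Q16 →+ H2C G256 := pull (SemidirectProduct.rightHom : G256 →* Q16)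

/-- The class `c` is represented by the cocycle `c_π`,
`c_π(χ q, χ' q') = (q χ')(piC(q))` for `χ, χ' ∈ Hom(A16, ℂˣ)` and `q, q' ∈ Q16`. -/
def IsCπ (c : H2C G256) : Prop :=
  ∃ f : Z2C G256, cls f = c ∧ ∀ g h, cval f g h = (charAct g.right h.left) (piC g.right)

end CentralType

end

open CentralType

/-!
For a finite group `G` the algebra `ℂ^f G` is a matrix algebra exactly when its centre is `ℂ`, and
this happens exactly when no `g ≠ 1` is *regular*, i.e. when for every `g ≠ 1` some `h` commuting
with `g` has `α_f(g, h) ≠ 1` (`nondeg_iff`). One direction looks at the class sum of `g`, which is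
central; in the other direction averaging over conjugates produces a nonzero scalar in every nonzero
ideal, so that the algebra is simple and Wedderburn's theorem applies. Thus non-degeneracy can be
read off from the form `α` of a class. On a finite abelian group the form even determines the class
(`eq_of_form_eq`), because the twisted group algebra of a symmetric cocycle is commutative and
therefore has a character, which trivialises the cocycle.

*Construction of classes.* Let `Q = C_k × C_k` act on `V = (ℤ/m)²` through `SL₂`, with `k` prime to
`m`. Averaging `v₀ w₁` over `Q` gives an invariant bilinear form `B` with `B(v, w) - B(w, v)` the
determinant, and `χ(B(v, q v'))` is a 2-cocycle of `V ⋊ Q` for each character `χ` of `ℤ/m`. Since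
the order of `q` is prime to `m`, an element `v q` is conjugate to `q` unless `v` pairs
non-trivially with a vector fixed by `q` (`isTransverse_vecZ2`). Hence multiplying by any
non-degenerate class inflated from `Q` gives a non-degenerate class (`IsTransverse.nondeg`), and the
same holds for direct products of such groups.

*Cube-free order.* An automorphism of `G = V ⋊ Q` preserves the preimages of the kernels of the
three components of the action, since these are the centralisers of the `p_i`-torsion. So it sends
`x` and `y`, up to conjugation, to `x^j` and `y^j` with the same `j`, and raises `α(x, y)` to the
power `j²` (`exists_form_eq_pow_sq`). A primitive root of unity and its power with a non-square
exponent are therefore values of classes in different orbits.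

*A-type.* All non-degenerate classes of an elementary abelian group are equivalent, since
nondegenerate alternating forms of the same dimension are isometric (`autTransitive_of_module`).
The centre `⟨τ₁, τ₂⟩` of `G₁ × G₂` is isotropic for one of the two classes extending a given class
on the vectors and not for the other, so no automorphism moves one to the other.

*Order 256.* On functions on `Q`, let the characters act by multiplication by `χ ∘ π` and `Q` by
translations twisted by a cocycle `c`. These operators form a basis of the endomorphism algebra,
because `π` is bijective and characters are linearly independent, and their cocycle is
`c_π · inf c` (`nondeg_cπ_add`). The classes for trivial `c` and for `c` of order 4 are both
non-degenerate, but they have different orders.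
-/

namespace CentralType

/-! ### Cocycles, twisted group algebras and the form of a class -/

section Cocycles

variable {G H : Type} [Group G] [Group H]

theorem cval_mul_cval (f : Z2C G) (a b c : G) :
    cval f (a * b) c * cval f a b = cval f b c * cval f a (b * c) := by
  have h := (groupCohomology.mem_cocycles₂_iff (A := trivCoeff G) f).1 f.2 a b c
  exact congrArg Additive.toMul h

/-- A function satisfying the multiplicative 2-cocycle identity, as an element of `Z²(G, ℂˣ)`. -/
noncomputable def mkZ2 (F : G → G → ℂˣ)
    (hF : ∀ a b c, F (a * b) c * F a b = F b c * F a (b * c)) : Z2C G :=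
  ⟨fun x => Additive.ofMul (F x.1 x.2),
    (groupCohomology.mem_cocycles₂_iff (A := trivCoeff G) _).2 fun a b c =>
      congrArg Additive.ofMul (hF a b c)⟩

theorem z2_ext {f f' : Z2C G} (h : ∀ a b, cval f a b = cval f' a b) : f = f' :=
  groupCohomology.cocycles₂_ext fun a b => Additive.toMul.injective (h a b)

@[simp] theorem cval_add (f f' : Z2C G) (a b : G) :
    cval (f + f') a b = cval f a b * cval f' a b := rfl

@[simp] theorem cval_zero (a b : G) : cval (0 : Z2C G) a b = 1 := rfl

theorem cls_add (f f' : Z2C G) : cls (f + f') = cls f + cls f' :=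
  map_add (groupCohomology.H2π (trivCoeff G)).hom f f'

theorem cls_zero : cls (0 : Z2C G) = 0 :=
  map_zero (groupCohomology.H2π (trivCoeff G)).hom

theorem cls_nsmul (n : ℕ) (f : Z2C G) : cls (n • f) = n • cls f :=
  map_nsmul (groupCohomology.H2π (trivCoeff G)).hom n f

@[simp] theorem cval_nsmul (n : ℕ) (f : Z2C G) (a b : G) : cval (n • f) a b = cval f a b ^ n := by
  induction n with
  | zero => simp
  | succ n ih => rw [succ_nsmul, cval_add, ih, pow_succ]

theorem cls_eq_zero_of_coboundary (f : Z2C G) (X : G → ℂˣ)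
    (hX : ∀ a b, X a * X b = cval f a b * X (a * b)) : cls f = 0 := by
  rw [← cls_zero]
  refine (groupCohomology.H2π_eq_iff (A := trivCoeff G) f 0).2
    ⟨fun a => Additive.ofMul (X a), ?_⟩
  funext x
  show Additive.ofMul (X x.2 * (X (x.1 * x.2))⁻¹ * X x.1) = Additive.ofMul (cval f x.1 x.2 * 1⁻¹)
  congr 1
  rw [mul_right_comm, mul_comm (X x.2), hX]
  simp

/-- The pullback of a cocycle along a homomorphism. -/
noncomputable def pullZ (φ : G →* H) (f : Z2C H) : Z2C G :=
  mkZ2 (fun a b => cval f (φ a) (φ b)) fun a b c => by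
    simpa using cval_mul_cval f (φ a) (φ b) (φ c)

theorem pull_cls_eq (φ : G →* H) (f : Z2C H) : pull φ (cls f) = cls (pullZ φ f) :=
  pull_cls φ f _ fun _ _ => rfl

theorem form_cls' (f : Z2C G) {g h : G} (hc : Commute g h) :
    form (cls f) g h = cval f h g * (cval f g h)⁻¹ := by
  rw [form_cls f hc, cocycleForm, ← hc.eq, mul_inv_cancel_right]

theorem form_pull (φ : G →* H) (c : H2C H) {g h : G} (hc : Commute g h) :
    form (pull φ c) g h = form c (φ g) (φ h) := by
  obtain ⟨f, rfl⟩ := cls_surjective c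
  rw [pull_cls_eq, form_cls' _ hc, form_cls' _ (hc.map φ)]
  rfl

theorem form_add (c c' : H2C G) {g h : G} (hc : Commute g h) :
    form (c + c') g h = form c g h * form c' g h := by
  obtain ⟨f, rfl⟩ := cls_surjective c
  obtain ⟨f', rfl⟩ := cls_surjective c'
  rw [← cls_add, form_cls' _ hc, form_cls' _ hc, form_cls' _ hc]
  simp only [cval_add, mul_inv]
  exact mul_mul_mul_comm _ _ _ _

theorem form_zero {g h : G} (hc : Commute g h) : form (0 : H2C G) g h = 1 := by
  rw [← cls_zero, form_cls' _ hc]; simp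

theorem form_neg (c : H2C G) {g h : G} (hc : Commute g h) :
    form (-c) g h = (form c g h)⁻¹ := by
  rw [eq_inv_iff_mul_eq_one, ← form_add _ _ hc, neg_add_cancel, form_zero hc]

theorem form_symm (c : H2C G) {g h : G} (hc : Commute g h) : form c h g = (form c g h)⁻¹ := by
  obtain ⟨f, rfl⟩ := cls_surjective c
  rw [form_cls' _ hc, form_cls' _ hc.symm, mul_inv, inv_inv, mul_comm]

theorem form_self (c : H2C G) (g : G) : form c g g = 1 := by
  obtain ⟨f, rfl⟩ := cls_surjective c
  rw [form_cls' _ (Commute.refl g), mul_inv_cancel]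

end Cocycles

section TwistedBasis

variable {G : Type} [Group G] {f : Z2C G} {A : Type} [Ring A] [Algebra ℂ A] {u : G → A}

/-- In a twisted group algebra conjugation by `u_h` permutes the basis vectors up to the scalars
`α_f(g, h)`. -/
theorem twisted_conj (hu : ∀ g h, u g * u h = (cval f g h : ℂ) • u (g * h)) (g h : G) :
    u h * u g = (cocycleForm f g h : ℂ) • (u (h * g * h⁻¹) * u h) := by
  rw [hu, hu, smul_smul, cocycleForm, ← Units.val_mul]
  simp

theorem cval_one_left (f : Z2C G) (g : G) : cval f 1 g = cval f 1 1 := by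
  have := cval_mul_cval f 1 1 g
  simp only [one_mul, mul_right_inj] at this
  exact this.symm

theorem cval_one_right (f : Z2C G) (g : G) : cval f g 1 = cval f 1 1 := by
  have := cval_mul_cval f g 1 1
  simp only [mul_one, mul_left_inj] at this
  exact this

end TwistedBasis

section Regular

variable {G : Type} [Group G]

/-- The operator of left multiplication by `u_g` on the twisted group algebra, written on
coordinate functions `G → ℂ`. -/
noncomputable def twistedLeft (f : Z2C G) (g : G) : Module.End ℂ (G → ℂ) where
  toFun φ l := (cval f g (g⁻¹ * l) : ℂ) * φ (g⁻¹ * l)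
  map_add' φ ψ := by ext l; simp [mul_add]
  map_smul' a φ := by ext l; simp [mul_left_comm]

theorem twistedLeft_mul (f : Z2C G) (g h : G) :
    twistedLeft f g * twistedLeft f h = (cval f g h : ℂ) • twistedLeft f (g * h) := by
  ext φ l : 2
  have := congrArg (Units.val) (cval_mul_cval f g h (h⁻¹ * (g⁻¹ * l)))
  simp only [mul_inv_cancel_left, Units.val_mul] at this
  show (cval f g (g⁻¹ * l) : ℂ) * (cval f h (h⁻¹ * (g⁻¹ * l)) * φ (h⁻¹ * (g⁻¹ * l))) =
    (cval f g h : ℂ) * (cval f (g * h) ((g * h)⁻¹ * l) * φ ((g * h)⁻¹ * l))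
  rw [_root_.mul_inv_rev, mul_assoc h⁻¹]
  linear_combination (-φ (h⁻¹ * (g⁻¹ * l))) * this

theorem twistedLeft_linearIndependent [Finite G] (f : Z2C G) :
    LinearIndependent ℂ (twistedLeft f) := by
  classical
  have := Fintype.ofFinite G
  rw [Fintype.linearIndependent_iff]
  intro a ha h
  have h1 := congrFun (LinearMap.congr_fun ha (Pi.single 1 1)) h
  simp only [LinearMap.sum_apply, LinearMap.smul_apply, Finset.sum_apply, Pi.smul_apply,
    LinearMap.zero_apply, Pi.zero_apply, smul_eq_mul] at h1
  rw [Finset.sum_eq_single h] at h1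
  · simpa [twistedLeft] using h1
  · intro b _ hb
    have : b⁻¹ * h ≠ 1 := fun e => hb (inv_mul_eq_one.1 e)
    simp [twistedLeft, this]
  · simp

/-- The span of the operators `twistedLeft f g`: the twisted group algebra `ℂ^f G`, realised by its
left regular representation. -/
noncomputable def TwAlg (f : Z2C G) : Subalgebra ℂ (Module.End ℂ (G → ℂ)) where
  carrier := Submodule.span ℂ (Set.range (twistedLeft f))
  add_mem' := Submodule.add_mem _
  mul_mem' {a b} ha hb := by
    have := Submodule.mul_mem_mul ha hb
    rw [Submodule.span_mul_span] at this
    refine Submodule.span_le.2 ?_ this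
    rintro _ ⟨_, ⟨g, rfl⟩, _, ⟨h, rfl⟩, rfl⟩
    show twistedLeft f g * twistedLeft f h ∈ _
    rw [twistedLeft_mul]
    exact Submodule.smul_mem _ _ (Submodule.subset_span ⟨_, rfl⟩)
  algebraMap_mem' r := by
    have h1 : algebraMap ℂ (Module.End ℂ (G → ℂ)) r =
        (r * (cval f 1 1 : ℂ)⁻¹) • twistedLeft f 1 := by
      ext φ l : 2
      show r * φ l = (r * (cval f 1 1 : ℂ)⁻¹) * (cval f 1 (1⁻¹ * l) * φ (1⁻¹ * l))
      rw [inv_one, one_mul, cval_one_left f l]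
      have := (cval f 1 1).ne_zero
      field_simp
    rw [h1]
    exact Submodule.smul_mem _ _ (Submodule.subset_span ⟨_, rfl⟩)

theorem isTwistedGroupAlgebra_twAlg [Finite G] (f : Z2C G) :
    IsTwistedGroupAlgebra f (TwAlg f) := by
  refine ⟨Module.Basis.span (twistedLeft_linearIndependent f), fun g h => ?_⟩
  apply Subtype.ext
  have e (x : G) : ((Module.Basis.span (twistedLeft_linearIndependent f) x :
      Submodule.span ℂ (Set.range (twistedLeft f))) : Module.End ℂ (G → ℂ)) = twistedLeft f x :=
    congrArg Subtype.val (Module.Basis.span_apply (twistedLeft_linearIndependent f) x)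
  exact (congrArg₂ (· * ·) (e g) (e h)).trans
    ((twistedLeft_mul f g h).trans (congrArg ((cval f g h : ℂ) • ·) (e (g * h)).symm))

end Regular

section FormLemmas

variable {G : Type} [Group G]

theorem twistedLeft_ne_zero [Finite G] (f : Z2C G) (g : G) : twistedLeft f g ≠ 0 :=
  (twistedLeft_linearIndependent f).ne_zero g

theorem twistedLeft_comm (f : Z2C G) {g h : G} (hc : Commute g h) :
    twistedLeft f h * twistedLeft f g =
      (form (cls f) g h : ℂ) • (twistedLeft f g * twistedLeft f h) := by
  rw [form_cls f hc, twisted_conj (twistedLeft_mul f) g h]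
  have : h * g * h⁻¹ = g := by rw [← hc.eq]; simp
  rw [this]

variable [Finite G]

/-- The form is the commutation factor of the basis vectors of the regular representation. -/
theorem form_unique (f : Z2C G) {g h : G} (hc : Commute g h) {a : ℂˣ}
    (ha : twistedLeft f h * twistedLeft f g = (a : ℂ) • (twistedLeft f g * twistedLeft f h)) :
    form (cls f) g h = a := by
  rw [twistedLeft_comm f hc, twistedLeft_mul, smul_smul, smul_smul] at ha
  have := smul_left_injective ℂ (twistedLeft_ne_zero f (g * h)) ha
  exact Units.ext (mul_right_cancel₀ (cval f g h).ne_zero this)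

theorem form_mul_right (c : H2C G) {g h h' : G} (hc : Commute g h) (hc' : Commute g h') :
    form c g (h * h') = form c g h * form c g h' := by
  obtain ⟨f, rfl⟩ := cls_surjective c
  refine form_unique f (hc.mul_right hc') ?_
  have hf := (cval f h h').ne_zero
  have e : twistedLeft f (h * h') =
      (cval f h h' : ℂ)⁻¹ • (twistedLeft f h * twistedLeft f h') := by
    rw [twistedLeft_mul, smul_smul, inv_mul_cancel₀ hf, one_smul]
  rw [e, smul_mul_assoc, mul_assoc, twistedLeft_comm f hc', mul_smul_comm, ← mul_assoc,
    twistedLeft_comm f hc]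
  simp only [smul_mul_assoc, mul_smul_comm, smul_smul, mul_assoc, Units.val_mul]
  congr 1
  ring

theorem form_mul_left (c : H2C G) {g g' h : G} (hc : Commute g h) (hc' : Commute g' h) :
    form c (g * g') h = form c g h * form c g' h := by
  rw [form_symm c (hc.mul_left hc').symm, form_mul_right c hc.symm hc'.symm, mul_inv,
    ← form_symm c hc.symm, ← form_symm c hc'.symm]

theorem form_one_right (c : H2C G) (g : G) : form c g 1 = 1 := by
  have := form_mul_right c (Commute.one_right g) (Commute.one_right g)
  rw [mul_one] at this
  exact (mul_eq_left.1 this.symm)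

theorem form_one_left (c : H2C G) (g : G) : form c 1 g = 1 := by
  rw [form_symm c (Commute.one_right g), form_one_right, inv_one]

theorem form_pow_right (c : H2C G) {g h : G} (hc : Commute g h) (n : ℕ) :
    form c g (h ^ n) = form c g h ^ n := by
  induction n with
  | zero => simp [form_one_right]
  | succ n ih => rw [pow_succ, form_mul_right c (hc.pow_right n) hc, ih, pow_succ]

theorem form_pow_left (c : H2C G) {g h : G} (hc : Commute g h) (n : ℕ) :
    form c (g ^ n) h = form c g h ^ n := by
  induction n with
  | zero => simp [form_one_left]
  | succ n ih => rw [pow_succ, form_mul_left c (hc.pow_left n) hc, ih, pow_succ]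

/-- The form of a class is invariant under inner automorphisms. -/
theorem form_conj (c : H2C G) {g h : G} (hc : Commute g h) (t : G) :
    form c (t * g * t⁻¹) (t * h * t⁻¹) = form c g h := by
  obtain ⟨f, rfl⟩ := cls_surjective c
  have hc' : Commute (t * g * t⁻¹) (t * h * t⁻¹) := hc.map (MulAut.conj t).toMonoidHom
  have kg := twisted_conj (twistedLeft_mul f) g t
  have kh := twisted_conj (twistedLeft_mul f) h t
  have e := congrArg (twistedLeft f t * ·) (twistedLeft_comm f hc)
  generalize t * g * t⁻¹ = g' at *
  generalize t * h * t⁻¹ = h' at *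
  have l1 : twistedLeft f t * (twistedLeft f h * twistedLeft f g) =
      (cocycleForm f h t * cocycleForm f g t * form (cls f) g' h' : ℂ) •
        (twistedLeft f g' * twistedLeft f h' * twistedLeft f t) := by
    rw [← mul_assoc, kh, smul_mul_assoc, mul_assoc, kg, mul_smul_comm, ← mul_assoc,
      twistedLeft_comm f hc', smul_mul_assoc, smul_smul, smul_smul, mul_assoc]
  have l2 : twistedLeft f t * (twistedLeft f g * twistedLeft f h) =
      (cocycleForm f g t * cocycleForm f h t : ℂ) •
        (twistedLeft f g' * twistedLeft f h' * twistedLeft f t) := by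
    rw [← mul_assoc, kg, smul_mul_assoc, mul_assoc, kh, mul_smul_comm, ← mul_assoc, smul_smul]
  simp only [mul_smul_comm] at e
  rw [l1, l2, smul_smul, twistedLeft_mul, smul_mul_assoc, twistedLeft_mul, smul_smul, smul_smul,
    smul_smul, smul_smul] at e
  have := smul_left_injective ℂ (twistedLeft_ne_zero f _) e
  apply Units.ext
  have n1 := (cocycleForm f h t).ne_zero
  have n2 := (cocycleForm f g t).ne_zero
  have n3 := (cval f g' h').ne_zero
  have n4 := (cval f (g' * h') t).ne_zero
  apply mul_right_cancel₀ (mul_ne_zero (mul_ne_zero n1 n2) (mul_ne_zero n3 n4))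
  linear_combination this

end FormLemmas

/-! ### The criterion for non-degeneracy -/

section Criterion

variable {G : Type} [Group G] {f : Z2C G} {A : Type} [Ring A] [Algebra ℂ A]
  {u : Module.Basis G ℂ A}

theorem twisted_one (hu : ∀ g h, u g * u h = (cval f g h : ℂ) • u (g * h)) :
    u 1 = (cval f 1 1 : ℂ) • (1 : A) := by
  have : LinearMap.mulLeft ℂ (u 1) = (cval f 1 1 : ℂ) • LinearMap.id := by
    refine u.ext fun g => ?_
    rw [LinearMap.mulLeft_apply, hu, one_mul, cval_one_left]
    rfl
  simpa using LinearMap.congr_fun this 1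

theorem twisted_isUnit (hu : ∀ g h, u g * u h = (cval f g h : ℂ) • u (g * h)) (g : G) :
    IsUnit (u g) := by
  have h1 (g : G) : u g * (((cval f g g⁻¹ * cval f 1 1)⁻¹ : ℂˣ) : ℂ) • u g⁻¹ = 1 := by
    rw [mul_smul_comm, hu, mul_inv_cancel, twisted_one hu, smul_smul, smul_smul,
      ← Units.val_mul, ← Units.val_mul, mul_assoc, inv_mul_cancel, Units.val_one, one_smul]
  have h2 := h1 g⁻¹
  rw [inv_inv, mul_smul_comm, ← smul_mul_assoc] at h2
  exact isUnit_iff_exists_and_exists.2 ⟨⟨_, h1 g⟩, ⟨_, h2⟩⟩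

variable {U : G → Aˣ}

theorem repr_mul_right (hu : ∀ g h, u g * u h = (cval f g h : ℂ) • u (g * h)) (x : A) (g h : G) :
    u.repr (x * u h) (g * h) = cval f g h * u.repr x g := by
  have : u.coord (g * h) ∘ₗ LinearMap.mulRight ℂ (u h) = (cval f g h : ℂ) • u.coord g := by
    classical
    refine u.ext fun g' => ?_
    simp only [LinearMap.comp_apply, LinearMap.mulRight_apply, hu, map_smul,
      Module.Basis.coord_apply, Module.Basis.repr_self, LinearMap.smul_apply,
      Finsupp.single_apply, mul_left_inj]
    split_ifs with h'
    · rw [h']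
    · simp
  simpa using LinearMap.congr_fun this x

theorem conj_basis (hu : ∀ g h, u g * u h = (cval f g h : ℂ) • u (g * h))
    (hU : ∀ g, (U g : A) = u g) (g h : G) :
    (U h : A) * u g * ((U h)⁻¹ : Aˣ) = (cocycleForm f g h : ℂ) • u (h * g * h⁻¹) := by
  rw [hU, twisted_conj hu, ← hU h, smul_mul_assoc, Units.mul_inv_cancel_right]

theorem repr_conj (hu : ∀ g h, u g * u h = (cval f g h : ℂ) • u (g * h))
    (hU : ∀ g, (U g : A) = u g) (x : A) (g h : G) :
    u.repr ((U h : A) * x * ((U h)⁻¹ : Aˣ)) (h * g * h⁻¹) =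
      cocycleForm f g h * u.repr x g := by
  have : u.coord (h * g * h⁻¹) ∘ₗ LinearMap.mulRight ℂ (((U h)⁻¹ : Aˣ) : A) ∘ₗ
      LinearMap.mulLeft ℂ (U h : A) = (cocycleForm f g h : ℂ) • u.coord g := by
    classical
    refine u.ext fun g' => ?_
    simp only [LinearMap.comp_apply, LinearMap.mulRight_apply, LinearMap.mulLeft_apply,
      conj_basis hu hU, map_smul, Module.Basis.coord_apply, Module.Basis.repr_self,
      LinearMap.smul_apply, Finsupp.single_apply, mul_left_inj, mul_right_inj]
    split_ifs with h'
    · rw [h']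
    · simp
  simpa using LinearMap.congr_fun this x

/-- The sum of all conjugates of an element by basis vectors is central. -/
theorem commute_sum_conj [Fintype G] (hu : ∀ g h, u g * u h = (cval f g h : ℂ) • u (g * h))
    (hU : ∀ g, (U g : A) = u g) (x y : A) :
    y * (∑ t, (U t : A) * x * ((U t)⁻¹ : Aˣ)) = (∑ t, (U t : A) * x * ((U t)⁻¹ : Aˣ)) * y := by
  set z := ∑ t, (U t : A) * x * ((U t)⁻¹ : Aˣ) with hz
  have key (r t : G) : (U r : A) * ((U t : A) * x * ((U t)⁻¹ : Aˣ)) * ((U r)⁻¹ : Aˣ) =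
      (U (r * t) : A) * x * ((U (r * t))⁻¹ : Aˣ) := by
    have h1 : (U r : A) * (U t : A) = (cval f r t : ℂ) • (U (r * t) : A) := by
      rw [hU, hU, hU, hu]
    have h2 : ((U t)⁻¹ : Aˣ) * ((U r)⁻¹ : Aˣ) =
        (((cval f r t)⁻¹ : ℂˣ) : ℂ) • (((U (r * t))⁻¹ : Aˣ) : A) := by
      rw [← Units.val_mul, ← _root_.mul_inv_rev]
      refine Units.inv_eq_of_mul_eq_one_right ?_
      rw [Units.val_mul, h1, smul_mul_smul_comm]
      simp
    calc _ = ((U r : A) * (U t : A)) * x * (((U t)⁻¹ : Aˣ) * ((U r)⁻¹ : Aˣ)) := by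
          simp only [mul_assoc]
      _ = _ := by
          rw [h1, h2, smul_mul_assoc, smul_mul_assoc, mul_smul_comm, smul_smul]
          simp
  have hr (r : G) : u r * z = z * u r := by
    have : (U r : A) * z * ((U r)⁻¹ : Aˣ) = z := by
      rw [hz, Finset.mul_sum, Finset.sum_mul]
      simp only [key]
      exact Fintype.sum_equiv (Equiv.mulLeft r) _ _ fun _ => rfl
    rw [← hU, ← Units.mul_inv_eq_iff_eq_mul]
    exact this
  have : LinearMap.mulRight ℂ z = LinearMap.mulLeft ℂ z := u.ext hr
  exact LinearMap.congr_fun this y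

/-- In a non-degenerate twisted group algebra the class sum of `g ≠ 1` is scalar, so it
vanishes, which means that some element commuting with `g` acts on `u_g` by a non-trivial
scalar. -/
theorem exists_form_ne_one_of_central [Finite G] [Algebra.IsCentral ℂ A]
    (hu : ∀ g h, u g * u h = (cval f g h : ℂ) • u (g * h)) {g : G} (hg : g ≠ 1) :
    ∃ h, Commute g h ∧ form (cls f) g h ≠ 1 := by
  classical
  have := Fintype.ofFinite G
  by_contra! hcon
  choose U hU using twisted_isUnit hu
  set z := ∑ t, (U t : A) * u g * ((U t)⁻¹ : Aˣ) with hz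
  have hc : z ∈ Subalgebra.center ℂ A :=
    Subalgebra.mem_center_iff.2 fun y => commute_sum_conj hu hU (u g) y
  obtain ⟨a, ha⟩ := Algebra.mem_bot.1 (Algebra.IsCentral.out hc)
  have h0 : u.repr z g = 0 := by
    have : z = (a * (cval f 1 1 : ℂ)⁻¹) • u 1 := by
      rw [twisted_one hu, smul_smul, mul_assoc, inv_mul_cancel₀ (Units.ne_zero _), mul_one, ← ha,
        Algebra.algebraMap_eq_smul_one]
    rw [this, map_smul, Module.Basis.repr_self, Finsupp.smul_apply,
      Finsupp.single_eq_of_ne hg, smul_zero]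
  have h1 : u.repr z g = ∑ t : G, if t * g * t⁻¹ = g then (1 : ℂ) else 0 := by
    rw [hz, map_sum, Finsupp.finsetSum_apply]
    refine Finset.sum_congr rfl fun t _ => ?_
    rw [conj_basis hu hU, map_smul, Module.Basis.repr_self, Finsupp.smul_apply,
      Finsupp.single_apply]
    split_ifs with ht
    · have hct : Commute g t := (mul_inv_eq_iff_eq_mul.1 ht).symm
      rw [← form_cls f hct, hcon t hct]
      simp
    · simp
  rw [h1, ← Finset.natCast_card_filter, Nat.cast_eq_zero, Finset.card_eq_zero] at h0
  have : (1 : G) ∈ ({t : G | t * g * t⁻¹ = g} : Finset G) := by simp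
  rw [h0] at this
  simp at this

/-- If no `g ≠ 1` is regular, every nonzero ideal of the twisted group algebra contains, after
averaging over conjugates, a nonzero scalar. -/
theorem isSimpleRing_of_form [Finite G] (hu : ∀ g h, u g * u h = (cval f g h : ℂ) • u (g * h))
    (hf : ∀ g : G, g ≠ 1 → ∃ h, Commute g h ∧ form (cls f) g h ≠ 1) : IsSimpleRing A := by
  classical
  have := Fintype.ofFinite G
  choose U hU using twisted_isUnit hu
  have : Nontrivial A := ⟨u 1, 0, u.ne_zero 1⟩
  refine ⟨⟨fun I => or_iff_not_imp_left.2 fun hI => ?_⟩⟩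
  have ⟨x, hxI, hx⟩ : ∃ x ∈ I, x ≠ 0 := by
    by_contra! hcon
    exact hI (le_bot_iff.1 fun x hx => (TwoSidedIdeal.mem_bot A).2 (hcon x hx))
  have ⟨s, hs⟩ : ∃ s, u.repr x s ≠ 0 := by
    by_contra! hcon
    exact hx (u.repr.map_eq_zero_iff.1 (Finsupp.ext hcon))
  set y := x * u s⁻¹
  have hy : u.repr y 1 ≠ 0 := by
    have := repr_mul_right hu x s s⁻¹
    rw [mul_inv_cancel] at this
    rw [this]
    exact mul_ne_zero (Units.ne_zero _) hs
  set z := ∑ t, (U t : A) * y * ((U t)⁻¹ : Aˣ) with hz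
  have hzI : z ∈ I := sum_mem fun t _ => I.mul_mem_right _ _ (I.mul_mem_left _ _
    (I.mul_mem_right _ _ hxI))
  have hz1 : u.repr z 1 = Fintype.card G * u.repr y 1 := by
    rw [hz, map_sum, Finsupp.finsetSum_apply, Fintype.card, Finset.cast_card, Finset.sum_mul]
    refine Finset.sum_congr rfl fun t _ => ?_
    have := repr_conj hu hU y 1 t
    rw [mul_one, mul_inv_cancel] at this
    rw [this, cocycleForm, mul_one, mul_inv_cancel, cval_one_right, cval_one_left f t]
    simp
  -- A central element has no component at an element that is not regular.
  have hz0 (s : G) (hs : s ≠ 1) : u.repr z s = 0 := by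
    obtain ⟨h, hc, hne⟩ := hf s hs
    have hsc : h * s * h⁻¹ = s := by rw [← hc.eq]; simp
    have h2 := repr_conj hu hU z s h
    rw [commute_sum_conj hu hU y (U h : A), Units.mul_inv_cancel_right, ← hz, hsc,
      ← form_cls f hc] at h2
    have h3 : ((form (cls f) s h : ℂ) - 1) * u.repr z s = 0 := by linear_combination -h2
    refine (mul_eq_zero.1 h3).resolve_left fun h4 => hne (Units.ext ?_)
    simpa [sub_eq_zero] using h4
  have hz' : z = u.repr z 1 • u 1 := by
    apply u.repr.injective
    ext s
    rw [map_smul, Module.Basis.repr_self, Finsupp.smul_apply, Finsupp.single_apply]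
    split_ifs with h
    · simp [h]
    · simp [hz0 s (Ne.symm h)]
  have hne : u.repr z 1 * cval f 1 1 ≠ 0 := by
    rw [hz1]
    exact mul_ne_zero (mul_ne_zero (by simp) hy) (Units.ne_zero _)
  refine (TwoSidedIdeal.one_mem_iff I).1 ?_
  generalize u.repr z 1 = a at hz' hne
  have : (1 : A) = algebraMap ℂ A (a * cval f 1 1)⁻¹ * z := by
    rw [hz', twisted_one hu, smul_smul, ← Algebra.smul_def, smul_smul,
      inv_mul_cancel₀ hne, one_smul]
  rw [this]
  exact I.mul_mem_left _ _ hzI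

end Criterion

section NondegForm

variable {G : Type} [Group G] [Finite G]

/-- A cocycle is non-degenerate if and only if no `g ≠ 1` is regular for it. -/
theorem nondegCocycle_iff (f : Z2C G) :
    NondegCocycle f ↔ ∀ g : G, g ≠ 1 → ∃ h, Commute g h ∧ form (cls f) g h ≠ 1 := by
  constructor
  · rintro ⟨n, u, hu⟩ g hg
    exact exists_form_ne_one_of_central hu hg
  · intro hf
    obtain ⟨u, hu⟩ := isTwistedGroupAlgebra_twAlg f
    have := isSimpleRing_of_form hu hf
    have : FiniteDimensional ℂ (TwAlg f) := Module.Finite.of_basis u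
    obtain ⟨n, -, ⟨e⟩⟩ := IsSimpleRing.exists_algEquiv_matrix_of_isAlgClosed ℂ (TwAlg f)
    refine ⟨n, u.map e.toLinearEquiv, fun g h => ?_⟩
    show e (u g) * e (u h) = (cval f g h : ℂ) • e (u (g * h))
    rw [← map_mul, hu, map_smul]

theorem nondeg_iff (c : H2C G) :
    Nondeg c ↔ ∀ g : G, g ≠ 1 → ∃ h, Commute g h ∧ form c g h ≠ 1 := by
  constructor
  · rintro ⟨f, rfl, hf⟩
    exact (nondegCocycle_iff f).1 hf
  · intro h
    obtain ⟨f, rfl⟩ := cls_surjective c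
    exact ⟨f, rfl, (nondegCocycle_iff f).2 h⟩

end NondegForm

section Abelian

variable {G : Type} [Group G] [Finite G]

/-- A symmetric cocycle on a finite abelian group is a coboundary: its twisted group algebra is
commutative and therefore has a character, whose values on the basis trivialise the cocycle. -/
theorem cls_eq_zero_of_symm (hG : ∀ a b : G, a * b = b * a) (f : Z2C G)
    (hf : ∀ a b, cval f a b = cval f b a) : cls f = 0 := by
  obtain ⟨u, hu⟩ := isTwistedGroupAlgebra_twAlg f
  have hcomm (x y : TwAlg f) : x * y = y * x := by
    have : LinearMap.mul ℂ (TwAlg f) = (LinearMap.mul ℂ (TwAlg f)).flip := by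
      refine u.ext fun a => u.ext fun b => ?_
      simp only [LinearMap.mul_apply', LinearMap.flip_apply]
      rw [hu, hu, hf, hG]
    exact LinearMap.congr_fun (LinearMap.congr_fun this x) y
  let : CommRing (TwAlg f) := { (inferInstance : Ring (TwAlg f)) with mul_comm := hcomm }
  have : Nontrivial (TwAlg f) := ⟨u 1, 0, u.ne_zero 1⟩
  have : FiniteDimensional ℂ (TwAlg f) := Module.Finite.of_basis u
  obtain ⟨M, hM⟩ := Ideal.exists_maximal (TwAlg f)
  let := Ideal.Quotient.field M
  let e : ℂ ≃ₐ[ℂ] (TwAlg f ⧸ M) := AlgEquiv.ofBijective (Algebra.ofId ℂ _)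
    IsAlgClosed.algebraMap_bijective_of_isIntegral
  let χ : TwAlg f →ₐ[ℂ] ℂ := e.symm.toAlgHom.comp (Ideal.Quotient.mkₐ ℂ M)
  have hX (g : G) : χ (u g) ≠ 0 := ((twisted_isUnit hu g).map χ).ne_zero
  refine cls_eq_zero_of_coboundary f (fun g => Units.mk0 (χ (u g)) (hX g)) fun a b => ?_
  apply Units.ext
  show χ (u a) * χ (u b) = cval f a b * χ (u (a * b))
  rw [← map_mul, hu, map_smul, smul_eq_mul]

/-- A class on a finite abelian group is determined by its alternating form. -/
theorem eq_of_form_eq (hG : ∀ a b : G, a * b = b * a) (c c' : H2C G)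
    (h : ∀ a b, form c a b = form c' a b) : c = c' := by
  rw [← sub_eq_zero]
  obtain ⟨f, hf⟩ := cls_surjective (c - c')
  rw [← hf]
  refine cls_eq_zero_of_symm hG f fun a b => ?_
  have hc : Commute a b := hG a b
  have h1 : form (cls f) a b = 1 := by
    rw [hf, sub_eq_add_neg, form_add _ _ hc, form_neg _ hc, h, mul_inv_cancel]
  rw [form_cls' f hc, mul_inv_eq_one] at h1
  exact h1.symm

end Abelian

/-! ### Elementary abelian groups -/

section Symplectic

variable {F : Type} [Field F]

/-- A hyperbolic pair `x, y` of an alternating form splits off as an orthogonal summand. -/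
noncomputable def hyperbolicSplit {V : Type} [AddCommGroup V] [Module F V] (B : V →ₗ[F] V →ₗ[F] F)
    (hB : ∀ v, B v v = 0) {x y : V} (hxy : B x y = 1) :
    V ≃ₗ[F] F × F × (LinearMap.ker (B x) ⊓ LinearMap.ker (B y) : Submodule F V) where
  toFun v := (-B y v, B x v, ⟨v + B y v • x - B x v • y, by
    have hyx : B y x = -1 := by
      have := hB (x + y)
      simp only [map_add, LinearMap.add_apply, hB, hxy] at this
      linear_combination this
    simp [hB, hxy, hyx]⟩)
  map_add' v w := by
    refine Prod.ext ?_ (Prod.ext ?_ (Subtype.ext ?_))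
    · simp; ring
    · simp
    · simp [add_smul]; abel
  map_smul' a v := by
    refine Prod.ext ?_ (Prod.ext ?_ (Subtype.ext ?_))
    · simp
    · simp
    · simp [smul_sub, smul_smul]
  invFun p := p.1 • x + p.2.1 • y + p.2.2
  left_inv v := by simp
  right_inv p := by
    have hyx : B y x = -1 := by
      have := hB (x + y)
      simp only [map_add, LinearMap.add_apply, hB, hxy] at this
      linear_combination this
    obtain ⟨a, b, k, hk1, hk2⟩ := p
    rw [SetLike.mem_coe, LinearMap.mem_ker] at hk1 hk2
    refine Prod.ext ?_ (Prod.ext ?_ (Subtype.ext ?_))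
    · simp [hB, hyx, hk2]
    · simp [hB, hxy, hk1]
    · simp [hB, hxy, hyx, hk1, hk2]; abel

theorem hyperbolicSplit_symm_form {V : Type} [AddCommGroup V] [Module F V]
    (B : V →ₗ[F] V →ₗ[F] F) (hB : ∀ v, B v v = 0) {x y : V} (hxy : B x y = 1)
    (p q : F × F × (LinearMap.ker (B x) ⊓ LinearMap.ker (B y) : Submodule F V)) :
    B ((hyperbolicSplit B hB hxy).symm p) ((hyperbolicSplit B hB hxy).symm q) =
      p.1 * q.2.1 - p.2.1 * q.1 + B p.2.2 q.2.2 := by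
  have anti (v w : V) : B v w = -B w v := by
    have := hB (v + w)
    simp only [map_add, LinearMap.add_apply, hB] at this
    linear_combination this
  obtain ⟨a, b, k, hk1, hk2⟩ := p
  obtain ⟨a', b', k', hk1', hk2'⟩ := q
  rw [SetLike.mem_coe, LinearMap.mem_ker] at hk1 hk2 hk1' hk2'
  show B (a • x + b • y + k) (a' • x + b' • y + k') = a * b' - b * a' + B k k'
  simp [hB, hxy, anti y x, hk1', hk2', anti k x, anti k y, hk1, hk2]
  ring

/-- Nondegenerate alternating forms on spaces of the same finite dimension are isometric. -/
theorem exists_symplectic_isometry (n : ℕ) : ∀ (V W : Type) [AddCommGroup V] [Module F V]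
    [AddCommGroup W] [Module F W] [FiniteDimensional F V] [FiniteDimensional F W]
    (B : V →ₗ[F] V →ₗ[F] F) (C : W →ₗ[F] W →ₗ[F] F),
    Module.finrank F V = n → Module.finrank F W = n → (∀ v, B v v = 0) → (∀ w, C w w = 0) →
    (∀ v, (∀ w, B v w = 0) → v = 0) → (∀ v, (∀ w, C v w = 0) → v = 0) →
    ∃ e : V ≃ₗ[F] W, ∀ v w, C (e v) (e w) = B v w := by
  induction n using Nat.strong_induction_on with
  | _ n ih =>
    intro V W _ _ _ _ _ _ B C hV hW hB hC nB nC
    have pair : ∀ (U : Type) [AddCommGroup U] [Module F U] [FiniteDimensional F U]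
        (D : U →ₗ[F] U →ₗ[F] F), Module.finrank F U ≠ 0 →
        (∀ v, (∀ w, D v w = 0) → v = 0) → ∃ x y, D x y = 1 := by
      intro U _ _ _ D hU nD
      have : Nontrivial U := Module.nontrivial_of_finrank_pos (Nat.pos_of_ne_zero hU)
      obtain ⟨x, hx⟩ := exists_ne (0 : U)
      have ⟨w, hw⟩ : ∃ w, D x w ≠ 0 := by
        by_contra! hcon
        exact hx (nD x hcon)
      exact ⟨x, (D x w)⁻¹ • w, by simp [hw]⟩
    -- The form stays nondegenerate on the complement of a hyperbolic plane.
    have nondeg : ∀ (U : Type) [AddCommGroup U] [Module F U] (D : U →ₗ[F] U →ₗ[F] F)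
        (hD : ∀ v, D v v = 0) (_ : ∀ v, (∀ w, D v w = 0) → v = 0) (x y : U) (hxy : D x y = 1)
        (k : (LinearMap.ker (D x) ⊓ LinearMap.ker (D y) : Submodule F U)),
        (∀ k' : (LinearMap.ker (D x) ⊓ LinearMap.ker (D y) : Submodule F U),
          D.domRestrict₁₂ _ _ k k' = 0) → k = 0 := by
      intro U _ _ D hD nD x y hxy k hk
      apply Subtype.ext
      refine nD _ fun w => ?_
      have h1 := hyperbolicSplit_symm_form D hD hxy (0, 0, k) (hyperbolicSplit D hD hxy w)
      rw [LinearEquiv.symm_apply_apply] at h1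
      have h2 : (hyperbolicSplit D hD hxy).symm (0, 0, k) = k := by
        show (0 : F) • x + (0 : F) • y + (k : U) = k
        simp
      have h3 := hk (hyperbolicSplit D hD hxy w).2.2
      rw [LinearMap.domRestrict₁₂_apply] at h3
      rw [h2, h3] at h1
      simpa using h1
    by_cases hn : n = 0
    · have : Subsingleton V := Module.finrank_zero_iff.1 (hV.trans hn)
      exact ⟨LinearEquiv.ofFinrankEq V W (hV.trans hW.symm), fun v w => by
        rw [Subsingleton.elim v 0]; simp⟩
    · obtain ⟨x, y, hxy⟩ := pair V B (hV ▸ hn) nB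
      obtain ⟨x', y', hxy'⟩ := pair W C (hW ▸ hn) nC
      have d1 := (hyperbolicSplit B hB hxy).finrank_eq
      have d2 := (hyperbolicSplit C hC hxy').finrank_eq
      rw [Module.finrank_prod, Module.finrank_prod, Module.finrank_self] at d1 d2
      obtain ⟨e, he⟩ := ih (n - 2) (by omega)
        (LinearMap.ker (B x) ⊓ LinearMap.ker (B y) : Submodule F V)
        (LinearMap.ker (C x') ⊓ LinearMap.ker (C y') : Submodule F W)
        (B.domRestrict₁₂ _ _) (C.domRestrict₁₂ _ _) (by omega) (by omega)
        (fun v => hB _) (fun v => hC _) (nondeg V B hB nB x y hxy)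
        (nondeg W C hC nC x' y' hxy')
      refine ⟨(hyperbolicSplit B hB hxy).trans
        (((LinearEquiv.refl F F).prodCongr ((LinearEquiv.refl F F).prodCongr e)).trans
          (hyperbolicSplit C hC hxy').symm), fun v w => ?_⟩
      have h1 := hyperbolicSplit_symm_form B hB hxy (hyperbolicSplit B hB hxy v)
        (hyperbolicSplit B hB hxy w)
      rw [LinearEquiv.symm_apply_apply, LinearEquiv.symm_apply_apply] at h1
      rw [h1]
      have h2 := he (hyperbolicSplit B hB hxy v).2.2 (hyperbolicSplit B hB hxy w).2.2
      rw [LinearMap.domRestrict₁₂_apply, LinearMap.domRestrict₁₂_apply] at h2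
      simp only [LinearEquiv.trans_apply]
      rw [hyperbolicSplit_symm_form, ← h2]
      rfl

end Symplectic

section ElementaryAbelian

/-- A primitive `n`-th root of unity in `ℂˣ`. -/
theorem exists_isPrimitiveRoot_units (n : ℕ) (hn : n ≠ 0) : ∃ ξ : ℂˣ, IsPrimitiveRoot ξ n :=
  ⟨_, ((Complex.isPrimitiveRoot_exp n hn).isUnit_unit hn)⟩

/-- On an abelian group of prime exponent `r`, the form of a class is the exponential of a bilinear
form over `𝔽_r`. -/
theorem exists_bilin_of_class {P : Type} [CommGroup P] [Finite P] {r : ℕ} [Fact r.Prime]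
    [Module (ZMod r) (Additive P)] (hexp : ∀ g : P, g ^ r = 1) {ξ : ℂˣ} (hξ : IsPrimitiveRoot ξ r)
    (c : H2C P) : ∃ B : Additive P →ₗ[ZMod r] Additive P →ₗ[ZMod r] ZMod r,
      ∀ g h : P, form c g h = AddChar.zmodChar r hξ.pow_eq_one (B (.ofMul g) (.ofMul h)) := by
  have inj : Function.Injective (AddChar.zmodChar r hξ.pow_eq_one) := by
    intro a b hab
    rw [AddChar.zmodChar_apply, AddChar.zmodChar_apply] at hab
    exact ZMod.val_injective r (hξ.pow_inj a.val_lt b.val_lt hab)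
  have ex (g h : P) : ∃ a, AddChar.zmodChar r hξ.pow_eq_one a = form c g h := by
    have h1 : form c g h ^ r = 1 := by
      rw [← form_pow_left c (Commute.all g h), hexp, form_one_left]
    obtain ⟨i, -, hi⟩ := (IsPrimitiveRoot.coe_units_iff.2 hξ).eq_pow_of_pow_eq_one
      (congrArg Units.val h1)
    exact ⟨i, by rw [AddChar.zmodChar_apply']; exact Units.ext hi⟩
  choose b hb using ex
  have add_right (g h h' : P) : b g (h * h') = b g h + b g h' := inj <| by
    rw [hb, AddChar.map_add_eq_mul, hb, hb,
      form_mul_right c (Commute.all g h) (Commute.all g h')]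
  have add_left (g g' h : P) : b (g * g') h = b g h + b g' h := inj <| by
    rw [hb, AddChar.map_add_eq_mul, hb, hb,
      form_mul_left c (Commute.all g h) (Commute.all g' h)]
  let L (h : P) : Additive P →+ ZMod r := AddMonoidHom.mk' (fun g => b g.toMul h)
    fun g g' => add_left g.toMul g'.toMul h
  let R (g : P) : Additive P →+ ZMod r := AddMonoidHom.mk' (fun h => b g h.toMul)
    fun h h' => add_right g h.toMul h'.toMul
  refine ⟨LinearMap.mk₂ (ZMod r) (fun g h => b g.toMul h.toMul)
    (fun g g' h => (L h.toMul).map_add g g')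
    (fun a g h => ZMod.map_smul (L h.toMul) a g) (fun g h h' => (R g.toMul).map_add h h')
    (fun a g h => ZMod.map_smul (R g.toMul) a h), fun g h => ?_⟩
  exact (hb g h).symm

/-- Non-degenerate classes on an elementary abelian group correspond to nondegenerate alternating
forms, and these are isometric. -/
theorem autTransitive_of_module {P : Type} [CommGroup P] [Finite P] {r : ℕ} [Fact r.Prime]
    [Module (ZMod r) (Additive P)] (hexp : ∀ g : P, g ^ r = 1) : AutTransitive P := by
  have : Module.Finite (ZMod r) (Additive P) := Module.Finite.of_finite
  obtain ⟨ξ, hξ⟩ := exists_isPrimitiveRoot_units r (Fact.out : r.Prime).ne_zero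
  have inj (a) (ha : AddChar.zmodChar r hξ.pow_eq_one a = 1) : a = 0 := by
    rw [AddChar.zmodChar_apply] at ha
    exact (ZMod.val_eq_zero a).1 (Nat.eq_zero_of_dvd_of_lt (hξ.dvd_of_pow_eq_one _ ha) a.val_lt)
  have key (c : H2C P) (hc : Nondeg c) : ∃ B : Additive P →ₗ[ZMod r] Additive P →ₗ[ZMod r] ZMod r,
      (∀ g h : P, form c g h = AddChar.zmodChar r hξ.pow_eq_one (B (.ofMul g) (.ofMul h))) ∧
      (∀ v, B v v = 0) ∧ ∀ v, (∀ w, B v w = 0) → v = 0 := by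
    obtain ⟨B, hB⟩ := exists_bilin_of_class hexp hξ c
    refine ⟨B, hB, fun v => inj _ ((hB v.toMul v.toMul).symm.trans (form_self c _)),
      fun v hv => ?_⟩
    by_contra hne
    obtain ⟨h, -, hh⟩ := (nondeg_iff c).1 hc v.toMul (fun e => hne (congrArg Additive.ofMul e))
    apply hh
    rw [hB]
    exact (congrArg _ (hv (.ofMul h))).trans (AddChar.map_zero_eq_one _)
  intro c c' hc hc'
  obtain ⟨B, hB, alt, nd⟩ := key c hc
  obtain ⟨B', hB', alt', nd'⟩ := key c' hc'
  obtain ⟨e, he⟩ := exists_symplectic_isometry _ _ _ B' B rfl rfl alt' alt nd' nd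
  let φ : MulAut P := MulEquiv.toAdditive.symm e.toAddEquiv
  refine ⟨φ⁻¹, eq_of_form_eq mul_comm _ _ fun a b => ?_⟩
  rw [autAct, form_pull _ _ (Commute.all a b), inv_inv, hB', hB, ← he]
  rfl

theorem autTransitive_of_elementary {P : Type} [Group P] [Finite P] {r : ℕ} (hr : r.Prime)
    (hcomm : ∀ g h : P, g * h = h * g) (hexp : ∀ g : P, g ^ r = 1) : AutTransitive P := by
  have := Fact.mk hr
  let : CommGroup P := { (inferInstance : Group P) with mul_comm := hcomm }
  let : Module (ZMod r) (Additive P) :=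
    AddCommGroup.zmodModule fun x => congrArg Additive.ofMul (hexp x.toMul)
  exact autTransitive_of_module hexp

end ElementaryAbelian

/-! ### Classes on `(ℤ/m)² ⋊ (C_k × C_k)` -/

section Transverse

variable {G Q : Type} [Group G] [Group Q]

/-- A class `a` on a group `G` with a homomorphism `π : G → Q` and a section `s` of `π` is
*transverse* to the section if its form vanishes on `s(Q)`, and every `g` that is not conjugate into
`s(Q)` is detected by the form of `a` against an element of `ker π` commuting with `g`. -/
structure IsTransverse (π : G →* Q) (s : Q →* G) (a : H2C G) : Prop where
  comp_eq : ∀ q, π (s q) = q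
  form_section : ∀ q q', Commute q q' → form a (s q) (s q') = 1
  exists_or_conj : ∀ g, (∃ h, π h = 1 ∧ Commute g h ∧ form a g h ≠ 1) ∨
    ∃ t, t * g * t⁻¹ = s (π g)

/-- Adding to a transverse class the inflation of a non-degenerate class of the quotient gives a
non-degenerate class. -/
theorem IsTransverse.nondeg [Finite G] [Finite Q] {π : G →* Q} {s : Q →* G} {a : H2C G}
    (ha : IsTransverse π s a) {b : H2C Q} (hb : Nondeg b) : Nondeg (a + pull π b) := by
  refine (nondeg_iff _).2 fun g hg => ?_
  obtain ⟨h, hπ, hc, hne⟩ | ⟨t, ht⟩ := ha.exists_or_conj g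
  · refine ⟨h, hc, ?_⟩
    rwa [form_add _ _ hc, form_pull _ _ hc, hπ, form_one_right, mul_one]
  · have hq : π g ≠ 1 := by
      intro h1
      rw [h1, map_one, mul_inv_eq_one, mul_eq_left] at ht
      exact hg ht
    obtain ⟨q', hc, hne⟩ := (nondeg_iff b).1 hb _ hq
    have hc' : Commute (s (π g)) (s q') := hc.map s
    have hg' : t⁻¹ * s (π g) * t⁻¹⁻¹ = g := by rw [← ht]; group
    refine ⟨t⁻¹ * s q' * t⁻¹⁻¹, ?_, ?_⟩
    · have := hc'.map (MulAut.conj t⁻¹).toMonoidHom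
      nth_rewrite 1 [← hg']
      exact this
    · nth_rewrite 1 [← hg']
      rw [form_conj _ hc', form_add _ _ hc', form_pull _ _ hc', ha.form_section _ _ hc, one_mul,
        ha.comp_eq, ha.comp_eq]
      exact hne

theorem IsTransverse.prod {G' Q' : Type} [Group G'] [Group Q'] [Finite G] [Finite G']
    {π : G →* Q} {s : Q →* G} {a : H2C G} (ha : IsTransverse π s a)
    {π' : G' →* Q'} {s' : Q' →* G'} {a' : H2C G'} (ha' : IsTransverse π' s' a') :
    IsTransverse (π.prodMap π') (s.prodMap s')
      (pull (MonoidHom.fst G G') a + pull (MonoidHom.snd G G') a') where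
  comp_eq q := Prod.ext (ha.comp_eq _) (ha'.comp_eq _)
  form_section q q' hq := by
    have hc : Commute (s.prodMap s' q) (s.prodMap s' q') := hq.map _
    rw [form_add _ _ hc, form_pull _ _ hc, form_pull _ _ hc]
    have h1 := ha.form_section q.1 q'.1 (hq.map (MonoidHom.fst Q Q'))
    have h2 := ha'.form_section q.2 q'.2 (hq.map (MonoidHom.snd Q Q'))
    simp only [MonoidHom.coe_fst, MonoidHom.coe_snd, MonoidHom.coe_prodMap, Prod.map_apply']
    rw [h1, h2, mul_one]
  exists_or_conj g := by
    obtain ⟨h, hπ, hc, hne⟩ | ⟨t, ht⟩ := ha.exists_or_conj g.1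
    · have hcom : Commute g (h, 1) := Prod.ext hc (Commute.one_right g.2)
      refine Or.inl ⟨(h, 1), Prod.ext hπ π'.map_one, hcom, ?_⟩
      rw [form_add _ _ hcom, form_pull _ _ hcom, form_pull _ _ hcom]
      simpa [form_one_right] using hne
    obtain ⟨h, hπ, hc, hne⟩ | ⟨t', ht'⟩ := ha'.exists_or_conj g.2
    · have hcom : Commute g (1, h) := Prod.ext (Commute.one_right g.1) hc
      refine Or.inl ⟨(1, h), Prod.ext π.map_one hπ, hcom, ?_⟩
      rw [form_add _ _ hcom, form_pull _ _ hcom, form_pull _ _ hcom]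
      simpa [form_one_right] using hne
    · exact Or.inr ⟨(t, t'), Prod.ext ht ht'⟩

end Transverse

section Bimultiplicative

variable {Q : Type} [Group Q]

/-- A bimultiplicative function is a 2-cocycle. -/
noncomputable def bimulZ2 (F : Q → Q → ℂˣ) (hl : ∀ a b c, F (a * b) c = F a c * F b c)
    (hr : ∀ a b c, F a (b * c) = F a b * F a c) : Z2C Q :=
  mkZ2 F fun a b c => by
    rw [hl, hr]
    generalize F a c = x
    generalize F b c = y
    generalize F a b = z
    rw [mul_comm x y, mul_assoc, mul_comm x z]

end Bimultiplicative

section SLProd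

/-- The determinant form on `(ℤ/m)²`. -/
def det2 {m : ℕ} (v w : Fin 2 → ZMod m) : ZMod m := v 0 * w 1 - v 1 * w 0

theorem det2_mulVec {m : ℕ} (A : SpecialLinearGroup (Fin 2) (ZMod m)) (v w : Fin 2 → ZMod m) :
    det2 (A.1 *ᵥ v) (A.1 *ᵥ w) = det2 v w := by
  have := A.2
  rw [Matrix.det_fin_two] at this
  simp only [det2, Matrix.mulVec, dotProduct, Fin.sum_univ_two]
  linear_combination (v 0 * w 1 - v 1 * w 0) * this

theorem exists_det2_ne_one {m : ℕ} {χ : AddChar (ZMod m) ℂˣ} (hχ : χ.IsPrimitive)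
    {v : Fin 2 → ZMod m} (hv : v ≠ 0) : ∃ w, χ (det2 w v) ≠ 1 := by
  have ⟨u, hu⟩ : ∃ u, det2 u v ≠ 0 := by
    by_contra! hcon
    apply hv
    have h0 := hcon ![0, -1]
    have h1 := hcon ![1, 0]
    ext i
    fin_cases i
    · simpa [det2] using h0
    · simpa [det2] using h1
  by_contra! hcon
  refine hχ hu (DFunLike.ext _ _ fun b => ?_)
  rw [AddChar.mulShift_apply]
  refine Eq.trans ?_ (hcon (b • u))
  congr 1
  simp [det2]
  ring

variable {m k : ℕ} (η : CC k →* SpecialLinearGroup (Fin 2) (ZMod m))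

/-- The action of `q ∈ C_k × C_k` on the vectors of `(ℤ/m)²`. -/
def vact (q : CC k) : (Fin 2 → ZMod m) →ₗ[ZMod m] (Fin 2 → ZMod m) := (η q).1.mulVecLin

theorem vact_apply (q : CC k) (v : Fin 2 → ZMod m) : vact η q v = (η q).1 *ᵥ v := rfl

theorem vact_one (v : Fin 2 → ZMod m) : vact η 1 v = v := by simp [vact]

theorem vact_mul (q q' : CC k) (v : Fin 2 → ZMod m) :
    vact η (q * q') v = vact η q (vact η q' v) := by simp [vact]

theorem det2_vact (q : CC k) (v w : Fin 2 → ZMod m) :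
    det2 (vact η q v) (vact η q w) = det2 v w := det2_mulVec _ _ _

theorem slprod_mul_left (g h : SLProd η) :
    Multiplicative.toAdd (g * h).left =
      Multiplicative.toAdd g.left + vact η g.right (Multiplicative.toAdd h.left) := rfl

theorem cc_pow_eq_one (q : CC k) : q ^ k = 1 := by
  refine Prod.ext ?_ ?_ <;>
  · apply Multiplicative.toAdd.injective
    simp

variable [NeZero k]

instance [NeZero m] : Finite (SLProd η) :=
  Finite.of_equiv _ SemidirectProduct.equivProd.symm

/-- The average over `C_k × C_k` of the translates of the bilinear form `v₀ w₁`. Unlike the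
determinant, this form can be used when `m` is even; unlike `v₀ w₁` it is invariant. -/
noncomputable def avgForm (v w : Fin 2 → ZMod m) : ZMod m :=
  ((k * k : ℕ) : ZMod m)⁻¹ * ∑ q : CC k, vact η q v 0 * vact η q w 1

theorem avgForm_add_left (v v' w : Fin 2 → ZMod m) :
    avgForm η (v + v') w = avgForm η v w + avgForm η v' w := by
  simp [avgForm, add_mul, Finset.sum_add_distrib, mul_add]

theorem avgForm_add_right (v w w' : Fin 2 → ZMod m) :
    avgForm η v (w + w') = avgForm η v w + avgForm η v w' := by
  simp [avgForm, Finset.sum_add_distrib, mul_add]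

theorem avgForm_vact (q : CC k) (v w : Fin 2 → ZMod m) :
    avgForm η (vact η q v) (vact η q w) = avgForm η v w := by
  unfold avgForm
  congr 1
  exact Fintype.sum_equiv (Equiv.mulRight q) _ _ fun r => by
    simp [vact_mul]

theorem avgForm_zero_left (w : Fin 2 → ZMod m) : avgForm η 0 w = 0 := by simp [avgForm]

theorem avgForm_sub (hk : k.Coprime m) (v w : Fin 2 → ZMod m) :
    avgForm η v w - avgForm η w v = det2 v w := by
  have h1 : ∀ q : CC k, vact η q v 0 * vact η q w 1 - vact η q w 0 * vact η q v 1 = det2 v w := by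
    intro q
    rw [← det2_vact η q v w, det2]
    ring
  rw [avgForm, avgForm, ← mul_sub, ← Finset.sum_sub_distrib, Finset.sum_congr rfl fun q _ => h1 q,
    Finset.sum_const, Finset.card_univ, Fintype.card_prod, Fintype.card_multiplicative, ZMod.card,
    nsmul_eq_mul, ← mul_assoc, mul_comm _⁻¹, ZMod.coe_mul_inv_eq_one _ (hk.mul_left hk), one_mul]

/-- The cocycle `(v q, v' q') ↦ χ(B(v, q v'))` for the averaged bilinear form `B`. -/
noncomputable def vecZ2 (χ : AddChar (ZMod m) ℂˣ) : Z2C (SLProd η) :=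
  mkZ2 (fun g h => χ (avgForm η (Multiplicative.toAdd g.left)
      (vact η g.right (Multiplicative.toAdd h.left)))) fun a b c => by
    rw [← AddChar.map_add_eq_mul, ← AddChar.map_add_eq_mul, slprod_mul_left, slprod_mul_left,
      SemidirectProduct.mul_right, map_add (vact η a.right), avgForm_add_left, avgForm_add_right,
      vact_mul, avgForm_vact]
    congr 1
    ring

theorem cval_vecZ2 (χ : AddChar (ZMod m) ℂˣ) (g h : SLProd η) :
    cval (vecZ2 η χ) g h = χ (avgForm η (Multiplicative.toAdd g.left)
      (vact η g.right (Multiplicative.toAdd h.left))) := rfl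

theorem form_vecZ2_inr (χ : AddChar (ZMod m) ℂˣ) (q q' : CC k) :
    form (cls (vecZ2 η χ)) (SemidirectProduct.inr q) (SemidirectProduct.inr q') = 1 := by
  have hc : Commute q q' := Commute.all q q'
  rw [form_cls' _ (hc.map SemidirectProduct.inr), cval_vecZ2, cval_vecZ2]
  simp [avgForm_zero_left]

omit [NeZero k] in
theorem commute_inl {g : SLProd η} {w : Fin 2 → ZMod m} (hw : vact η g.right w = w) :
    Commute g (SemidirectProduct.inl (Multiplicative.ofAdd w)) := by
  refine SemidirectProduct.ext ?_ ?_
  · apply Multiplicative.toAdd.injective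
    rw [slprod_mul_left, slprod_mul_left]
    simp [hw, vact_one, add_comm]
  · simp

theorem form_vecZ2_inl (hk : k.Coprime m) (χ : AddChar (ZMod m) ℂˣ) {g : SLProd η}
    {w : Fin 2 → ZMod m} (hw : vact η g.right w = w) :
    form (cls (vecZ2 η χ)) g (SemidirectProduct.inl (Multiplicative.ofAdd w)) =
      χ (det2 w (Multiplicative.toAdd g.left)) := by
  rw [form_cls' _ (commute_inl η hw), cval_vecZ2, cval_vecZ2, ← avgForm_sub η hk,
    AddChar.map_sub_eq_div, div_eq_mul_inv]
  simp [hw, vact_one]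

/-- If `v` has no component fixed by `q` then `v = q x - x` is conjugated away; otherwise a vector
fixed by `q` pairs non-trivially with `v` under the determinant. -/
theorem isTransverse_vecZ2 (hk : k.Coprime m) (χ : AddChar (ZMod m) ℂˣ) (hχ : χ.IsPrimitive) :
    IsTransverse (SemidirectProduct.rightHom : SLProd η →* CC k) SemidirectProduct.inr
      (cls (vecZ2 η χ)) where
  comp_eq q := SemidirectProduct.rightHom_inr q
  form_section q q' _ := form_vecZ2_inr η χ q q'
  exists_or_conj g := by
    set q := g.right with hq
    set v := Multiplicative.toAdd g.left with hv
    -- The sum over the powers of `q` is `k` times the projection of `v` to the fixed vectors.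
    by_cases hs : ∑ j ∈ Finset.range k, vact η (q ^ j) v = 0
    · right
      set x := (k : ZMod m)⁻¹ • ∑ j ∈ Finset.range k, ∑ i ∈ Finset.range j, vact η (q ^ i) v
        with hx
      -- The geometric sums `1 + q + ... + q ^ (j - 1)` satisfy `(1 - q) (...) = 1 - q ^ j`.
      have tele (j : ℕ) : vact η q (∑ i ∈ Finset.range j, vact η (q ^ i) v) =
          ∑ i ∈ Finset.range j, vact η (q ^ i) v + vact η (q ^ j) v - v := by
        induction j with
        | zero => simp [vact_one]
        | succ j ih =>
          rw [Finset.sum_range_succ, map_add, ih, ← vact_mul, ← pow_succ']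
          abel
      have hxv : vact η q x = x - v := by
        rw [hx, map_smul, map_sum, Finset.sum_congr rfl fun j _ => tele j,
          Finset.sum_sub_distrib, Finset.sum_add_distrib, hs, add_zero, Finset.sum_const,
          Finset.card_range, smul_sub, ← Nat.cast_smul_eq_nsmul (ZMod m), smul_smul,
          mul_comm, ZMod.coe_mul_inv_eq_one _ hk, one_smul]
      refine ⟨(SemidirectProduct.inl (Multiplicative.ofAdd x))⁻¹, ?_⟩
      rw [inv_inv]
      refine SemidirectProduct.ext ?_ ?_
      · apply Multiplicative.toAdd.injective
        rw [slprod_mul_left, ← map_inv, slprod_mul_left]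
        simp only [SemidirectProduct.left_inl, SemidirectProduct.right_inl, vact_one,
          SemidirectProduct.mul_right, one_mul, ← hq, ← hv, toAdd_ofAdd, toAdd_inv, hxv,
          SemidirectProduct.left_inr, toAdd_one]
        abel
      · simp
    · left
      obtain ⟨u, hu⟩ := exists_det2_ne_one hχ hs
      set w := ∑ j ∈ Finset.range k, vact η (q ^ j)⁻¹ u with hw
      have hdet : det2 w v = det2 u (∑ j ∈ Finset.range k, vact η (q ^ j) v) := by
        have hd (j : ℕ) : det2 (vact η (q ^ j)⁻¹ u) v = det2 u (vact η (q ^ j) v) := by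
          rw [← det2_vact η (q ^ j), ← vact_mul, mul_inv_cancel, vact_one]
        have l1 : det2 w v = ∑ j ∈ Finset.range k, det2 (vact η (q ^ j)⁻¹ u) v := by
          simp [hw, det2, Finset.sum_apply, Finset.sum_mul]
        rw [l1, Finset.sum_congr rfl fun j _ => hd j]
        simp [det2, Finset.sum_apply, Finset.mul_sum]
      have hw' : vact η q⁻¹ w = w := by
        have h1 := Finset.sum_range_succ (fun j => vact η (q ^ j)⁻¹ u) k
        rw [Finset.sum_range_succ', cc_pow_eq_one, pow_zero, add_left_inj] at h1
        rw [hw, map_sum, ← h1]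
        refine Finset.sum_congr rfl fun j _ => ?_
        rw [← vact_mul, pow_succ, _root_.mul_inv_rev]
      have hwq : vact η q w = w := by
        conv_lhs => rw [← hw']
        rw [← vact_mul, mul_inv_cancel, vact_one]
      refine ⟨SemidirectProduct.inl (Multiplicative.ofAdd w), by simp, commute_inl η hwq, ?_⟩
      rw [form_vecZ2_inl η hk χ hwq, ← hv, hdet]
      exact hu

end SLProd

/-! ### Groups of cube-free order -/

section CyclicSquare

variable {k : ℕ} [NeZero k]

/-- The class of the cocycle `(x^a y^b, x^c y^d) ↦ ξ^(b c)` on `C_k × C_k`. -/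
noncomputable def ccZ2 {ξ : ℂˣ} (hξ : ξ ^ k = 1) : Z2C (CC k) :=
  bimulZ2 (fun q q' => AddChar.zmodChar k hξ (q.2.toAdd * q'.1.toAdd))
    (fun a b c => by
      rw [← AddChar.map_add_eq_mul, ← add_mul]; rfl)
    (fun a b c => by
      rw [← AddChar.map_add_eq_mul, ← mul_add]; rfl)

theorem form_ccZ2 {ξ : ℂˣ} (hξ : ξ ^ k = 1) (q q' : CC k) :
    form (cls (ccZ2 hξ)) q q' = AddChar.zmodChar k hξ
      (q'.2.toAdd * q.1.toAdd - q.2.toAdd * q'.1.toAdd) := by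
  rw [form_cls' _ (Commute.all q q'), AddChar.map_sub_eq_div, div_eq_mul_inv]
  rfl

theorem zmodChar_eq_one_iff {ξ : ℂˣ} (hξ : IsPrimitiveRoot ξ k) (a : ZMod k) :
    AddChar.zmodChar k hξ.pow_eq_one a = 1 ↔ a = 0 := by
  rw [AddChar.zmodChar_apply, hξ.pow_eq_one_iff_dvd]
  refine ⟨fun h => (ZMod.val_eq_zero a).1 (Nat.eq_zero_of_dvd_of_lt h a.val_lt), fun h => ?_⟩
  simp [h]

theorem zmodChar_one {ξ : ℂˣ} (hξ : ξ ^ k = 1) : AddChar.zmodChar k hξ 1 = ξ := by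
  simpa using AddChar.zmodChar_apply' hξ 1

theorem nondeg_ccZ2 {ξ : ℂˣ} (hξ : IsPrimitiveRoot ξ k) : Nondeg (cls (ccZ2 hξ.pow_eq_one)) := by
  refine (nondeg_iff _).2 fun q hq => ?_
  by_cases h1 : q.1.toAdd = 0
  · refine ⟨CC.x k, Commute.all _ _, fun h => ?_⟩
    rw [form_ccZ2, zmodChar_eq_one_iff hξ] at h
    refine hq (Prod.ext (Multiplicative.toAdd.injective h1) (Multiplicative.toAdd.injective ?_))
    simpa [CC.x] using h
  · refine ⟨CC.y k, Commute.all _ _, fun h => h1 ?_⟩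
    rw [form_ccZ2, zmodChar_eq_one_iff hξ] at h
    simpa [CC.y] using h

theorem exists_isPrimitive_addChar (m : ℕ) [NeZero m] :
    ∃ χ : AddChar (ZMod m) ℂˣ, χ.IsPrimitive := by
  obtain ⟨ζ, hζ⟩ := exists_isPrimitiveRoot_units m (NeZero.ne m)
  exact ⟨_, AddChar.zmodChar_primitive_of_primitive_root m hζ⟩

/-- `(ℤ/m)² ⋊ (C_k × C_k)` carries a non-degenerate class with prescribed primitive value on the
generators of `C_k × C_k`. -/
theorem exists_nondeg_slprod {m : ℕ} [NeZero m] (hk : k.Coprime m)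
    (η : CC k →* SpecialLinearGroup (Fin 2) (ZMod m)) {ξ : ℂˣ} (hξ : IsPrimitiveRoot ξ k) :
    ∃ c : H2C (SLProd η), Nondeg c ∧
      form c (SemidirectProduct.inr (CC.x k)) (SemidirectProduct.inr (CC.y k)) = ξ := by
  obtain ⟨χ, hχ⟩ := exists_isPrimitive_addChar m
  refine ⟨_, (isTransverse_vecZ2 η hk χ hχ).nondeg (nondeg_ccZ2 hξ), ?_⟩
  have hc : Commute (SemidirectProduct.inr (CC.x k) : SLProd η)
      (SemidirectProduct.inr (CC.y k)) :=
    (Commute.all (CC.x k) (CC.y k)).map SemidirectProduct.inr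
  rw [form_add _ _ hc, form_vecZ2_inr, form_pull _ _ hc, SemidirectProduct.rightHom_inr,
    SemidirectProduct.rightHom_inr, form_ccZ2, one_mul]
  simp [CC.x, CC.y, zmodChar_one]

/-- The homomorphism from `C_k` sending the generator to an element of exponent `k`. -/
def powHom {M : Type} [Monoid M] {g : M} (hg : g ^ k = 1) : Multiplicative (ZMod k) →* M where
  toFun a := g ^ a.toAdd.val
  map_one' := by simp
  map_mul' a b := by
    rw [← pow_add, toAdd_mul, ZMod.val_add, ← pow_eq_pow_mod _ hg]

theorem powHom_injective {M : Type} [Monoid M] {g : M} (hg : orderOf g = k) :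
    Function.Injective (powHom (k := k) (hg ▸ pow_orderOf_eq_one g)) := by
  intro a b h
  apply Multiplicative.toAdd.injective
  refine ZMod.val_injective k (pow_injOn_Iio_orderOf ?_ ?_ h)
  · rw [hg]; exact ZMod.val_lt _
  · rw [hg]; exact ZMod.val_lt _

end CyclicSquare

section ExistsAction

/-- `SL₂(𝔽_p)` has an element of each prime order `k` dividing `p² - 1`, by Cauchy's theorem for
the kernel of the determinant on `GL₂(𝔽_p)`. -/
theorem exists_orderOf_eq_sl2 {p k : ℕ} (hp : p.Prime) (hk : k.Prime)
    (h : (p : ℤ) ≡ 1 [ZMOD k] ∨ (p : ℤ) ≡ -1 [ZMOD k]) :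
    ∃ g : SpecialLinearGroup (Fin 2) (ZMod p), orderOf g = k := by
  have := Fact.mk hp
  have := Fact.mk hk
  have hdvd : k ∣ Nat.card (GeneralLinearGroup.det (n := Fin 2) (R := ZMod p)).ker := by
    have h1 := Subgroup.card_mul_index (GeneralLinearGroup.det (n := Fin 2) (R := ZMod p)).ker
    rw [Subgroup.index_ker, Matrix.card_GL_field, Fin.prod_univ_two, ZMod.card] at h1
    have h2 : Nat.card (GeneralLinearGroup.det (n := Fin 2) (R := ZMod p)).range ∣ p - 1 := by
      have := Subgroup.card_subgroup_dvd_card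
        (GeneralLinearGroup.det (n := Fin 2) (R := ZMod p)).range
      rwa [Nat.card_units, Nat.card_zmod] at this
    obtain ⟨d, hd⟩ := h2
    have hr : 0 < Nat.card (GeneralLinearGroup.det (n := Fin 2) (R := ZMod p)).range :=
      Nat.card_pos
    have h3 : k ∣ p ^ 2 - 1 := by
      have : (k : ℤ) ∣ (p : ℤ) ^ 2 - 1 := by
        have e : (p : ℤ) ^ 2 - 1 = (p - 1) * (p - (-1)) := by ring
        rw [e]
        rcases h with h | h
        · exact Dvd.dvd.mul_right h.symm.dvd _
        · exact Dvd.dvd.mul_left h.symm.dvd _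
      have hp2 : 1 ≤ p ^ 2 := Nat.one_le_pow _ _ hp.pos
      exact_mod_cast (by push_cast [hp2]; exact this : (k : ℤ) ∣ ((p ^ 2 - 1 : ℕ) : ℤ))
    have h4 : Nat.card (GeneralLinearGroup.det (n := Fin 2) (R := ZMod p)).ker =
        (p ^ 2 - 1) * p * d := by
      apply Nat.eq_of_mul_eq_mul_right hr
      rw [h1, mul_assoc _ d, mul_comm d, ← hd]
      simp only [Fin.val_zero, Fin.val_one, pow_zero, pow_one, mul_assoc]
      congr 1
      rw [Nat.mul_sub, sq, mul_one]
    rw [h4, mul_assoc]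
    exact Dvd.dvd.mul_right h3 _
  obtain ⟨g, hg⟩ := exists_prime_orderOf_dvd_card' k hdvd
  have ⟨s, hs⟩ : ∃ s : SpecialLinearGroup (Fin 2) (ZMod p), SpecialLinearGroup.toGL s = g :=
    ⟨⟨(g : GL (Fin 2) (ZMod p)).1, congrArg Units.val g.2⟩, Units.ext rfl⟩
  refine ⟨s, ?_⟩
  rw [← orderOf_injective _ SpecialLinearGroup.toGL_injective, hs, Subgroup.orderOf_coe, hg]

theorem exists_hasKernels {k : ℕ} {p : Fin 3 → ℕ} (hk : k.Prime) (hp : ∀ i, (p i).Prime)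
    (hinj : Function.Injective p)
    (hpk : ∀ i, (p i : ℤ) ≡ 1 [ZMOD k] ∨ (p i : ℤ) ≡ -1 [ZMOD k]) : ∃ η, HasKernels p k η := by
  have := NeZero.mk hk.ne_zero
  choose g hg using fun i => exists_orderOf_eq_sl2 (hp i) hk (hpk i)
  -- Three quotient maps to `C_k` with the kernels `⟨x⟩`, `⟨y⟩` and `⟨x y⟩`.
  let δ : Fin 3 → (CC k →* Multiplicative (ZMod k)) :=
    ![MonoidHom.snd _ _, MonoidHom.fst _ _, MonoidHom.fst _ _ / MonoidHom.snd _ _]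
  let θ (i : Fin 3) : CC k →* SpecialLinearGroup (Fin 2) (ZMod (p i)) :=
    (powHom (hg i ▸ pow_orderOf_eq_one (g i))).comp (δ i)
  have hθ (i : Fin 3) : (θ i).ker = (δ i).ker := by
    ext q
    rw [MonoidHom.mem_ker, MonoidHom.mem_ker, MonoidHom.comp_apply]
    exact map_eq_one_iff _ (powHom_injective (hg i))
  -- The three components are assembled by the Chinese remainder theorem.
  have hcop : Pairwise (Function.onFun Nat.Coprime p) := fun i j hij =>
    (Nat.coprime_primes (hp i) (hp j)).2 (hinj.ne hij)
  let e := ZMod.prodEquivPi p hcop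
  let Θ : CC k →* SpecialLinearGroup (Fin 2) (∀ i, ZMod (p i)) :=
    { toFun q := ⟨fun a b i => (θ i q).1 a b, by
        refine (Matrix.det_fin_two _).trans ?_
        funext i
        exact (Matrix.det_fin_two _).symm.trans (θ i q).2⟩
      map_one' := by
        apply Subtype.ext
        funext a b i
        simp [Matrix.one_apply]
        split_ifs <;> rfl
      map_mul' q r := by
        apply Subtype.ext
        funext a b i
        have h1 : (θ i (q * r)).1 = (θ i q).1 * (θ i r).1 := by rw [map_mul]; rfl
        refine (congrFun (congrFun h1 a) b).trans ?_
        refine (Matrix.mul_apply).trans ?_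
        refine Eq.symm ((congrFun (Matrix.mul_apply) i).trans ?_)
        rw [Finset.sum_apply]
        rfl }
  let η : CC k →* SpecialLinearGroup (Fin 2) (ZMod (∏ j, p j)) :=
    (SpecialLinearGroup.map e.symm.toRingHom).comp Θ
  have hη (i : Fin 3) : (slComponent p i).comp η = θ i := by
    ext q a b
    have hr : (ZMod.castHom (Finset.dvd_prod_of_mem p (Finset.mem_univ i)) (ZMod (p i))) =
        (Pi.evalRingHom (fun i => ZMod (p i)) i).comp e.toRingHom := RingHom.ext_zmod _ _
    show (ZMod.castHom (Finset.dvd_prod_of_mem p (Finset.mem_univ i)) (ZMod (p i)))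
      (e.symm fun i => (θ i q).1 a b) = (θ i q).1 a b
    rw [hr]
    show e (e.symm fun i => (θ i q).1 a b) i = _
    rw [RingEquiv.apply_symm_apply]
  have gen (a : Multiplicative (ZMod k)) : ∃ n : ℤ, Multiplicative.ofAdd (1 : ZMod k) ^ n = a :=
    ⟨(a.toAdd.val : ℤ), by
      apply Multiplicative.toAdd.injective
      simp⟩
  refine ⟨η, ?_, ?_, ?_⟩
  · rw [hη, hθ]
    ext q
    rw [MonoidHom.mem_ker, Subgroup.mem_zpowers_iff]
    show q.2 = 1 ↔ _
    constructor
    · intro h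
      obtain ⟨n, hn⟩ := gen q.1
      exact ⟨n, Prod.ext hn (by simp [CC.x, h])⟩
    · rintro ⟨n, rfl⟩
      simp [CC.x]
  · rw [hη, hθ]
    ext q
    rw [MonoidHom.mem_ker, Subgroup.mem_zpowers_iff]
    show q.1 = 1 ↔ _
    constructor
    · intro h
      obtain ⟨n, hn⟩ := gen q.2
      exact ⟨n, Prod.ext (by simp [CC.y, h]) hn⟩
    · rintro ⟨n, rfl⟩
      simp [CC.y]
  · rw [hη, hθ]
    ext q
    rw [MonoidHom.mem_ker, Subgroup.mem_zpowers_iff]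
    show q.1 / q.2 = 1 ↔ _
    rw [div_eq_one]
    constructor
    · intro h
      obtain ⟨n, hn⟩ := gen q.1
      exact ⟨n, Prod.ext (by simpa [CC.x, CC.y] using hn)
        (by rw [← h]; simpa [CC.x, CC.y] using hn)⟩
    · rintro ⟨n, rfl⟩
      simp [CC.x, CC.y]

end ExistsAction

section Kernels

variable {p : Fin 3 → ℕ} {k : ℕ} (η : CC k →* SpecialLinearGroup (Fin 2) (ZMod (∏ j, p j)))

theorem castHom_eq_zero_iff {n d : ℕ} [NeZero n] (h : d ∣ n) (a : ZMod n) :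
    ZMod.castHom h (ZMod d) a = 0 ↔ d ∣ a.val := by
  conv_lhs => rw [← ZMod.natCast_zmod_val a]
  rw [map_natCast, ZMod.natCast_eq_zero_iff]

theorem slComponent_eq_one_iff (i : Fin 3)
    (A : SpecialLinearGroup (Fin 2) (ZMod (∏ j, p j))) [NeZero (∏ j, p j)] :
    slComponent p i A = 1 ↔ ∀ a b, p i ∣ (A.1 a b - (1 : Matrix _ _ _) a b).val := by
  refine (Matrix.SpecialLinearGroup.ext_iff (slComponent p i A) 1).trans ?_
  refine forall_congr' fun a => forall_congr' fun b => ?_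
  rw [← castHom_eq_zero_iff (Finset.dvd_prod_of_mem p (Finset.mem_univ i)), map_sub, sub_eq_zero]
  have : (ZMod.castHom (Finset.dvd_prod_of_mem p (Finset.mem_univ i)) (ZMod (p i)))
      ((1 : Matrix (Fin 2) (Fin 2) _) a b) = (1 : Matrix _ _ _) a b := by
    rw [Matrix.one_apply, Matrix.one_apply]
    split_ifs
    · exact map_one _
    · exact map_zero _
  rw [this]
  rfl

/-- The kernel of the `i`-th component consists of the elements acting trivially on the
`p_i`-torsion vectors. -/
theorem mem_ker_slComponent_iff (hp : ∀ i, p i ≠ 0) (i : Fin 3) (q : CC k) :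
    q ∈ ((slComponent p i).comp η).ker ↔
      ∀ v : Fin 2 → ZMod (∏ j, p j), p i • v = 0 → vact η q v = v := by
  have : NeZero (∏ j, p j) := ⟨Finset.prod_ne_zero_iff.2 fun j _ => hp j⟩
  rw [MonoidHom.mem_ker, MonoidHom.comp_apply, slComponent_eq_one_iff]
  have hsub (v) : vact η q v - v = ((η q).1 - 1) *ᵥ v := by
    rw [Matrix.sub_mulVec, Matrix.one_mulVec, vact_apply]
  constructor
  · intro h v hv
    rw [← sub_eq_zero, hsub]
    funext a
    rw [Matrix.mulVec, dotProduct, Pi.zero_apply]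
    refine Finset.sum_eq_zero fun b _ => ?_
    obtain ⟨d, hd⟩ := h a b
    have hb := congrFun hv b
    rw [Pi.smul_apply, nsmul_eq_mul] at hb
    rw [Matrix.sub_apply, ← ZMod.natCast_zmod_val ((η q).1 a b - _), hd, Nat.cast_mul,
      mul_right_comm, hb]
    simp
  · intro h a b
    obtain ⟨d, hd⟩ := Finset.dvd_prod_of_mem p (Finset.mem_univ i)
    have hd0 : 0 < d := Nat.pos_of_ne_zero fun h0 => NeZero.ne (∏ j, p j) (by rw [hd, h0, mul_zero])
    have h1 := h (d • Pi.single b 1) (by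
      rw [smul_smul, ← hd, ← Nat.cast_smul_eq_nsmul (ZMod (∏ j, p j)), ZMod.natCast_self,
        zero_smul])
    rw [← sub_eq_zero, hsub, Matrix.mulVec_smul, Matrix.mulVec_single_one] at h1
    have h2 := congrFun h1 a
    rw [Pi.smul_apply, Matrix.col_apply, Pi.zero_apply, Matrix.sub_apply,
      ← ZMod.natCast_zmod_val ((η q).1 a b - _), nsmul_eq_mul, ← Nat.cast_mul,
      ZMod.natCast_eq_zero_iff, mul_comm d] at h2
    exact Nat.dvd_of_mul_dvd_mul_right hd0 ((dvd_of_eq hd.symm).trans h2)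

end Kernels

section Orbits

variable {m k : ℕ} (η : CC k →* SpecialLinearGroup (Fin 2) (ZMod m))

theorem commute_inl_iff {g : SLProd η} {w : Fin 2 → ZMod m} :
    Commute g (SemidirectProduct.inl (Multiplicative.ofAdd w)) ↔ vact η g.right w = w := by
  refine ⟨fun h => ?_, commute_inl η⟩
  have := congrArg (fun x => Multiplicative.toAdd (SemidirectProduct.left x)) h.eq
  simp only [slprod_mul_left] at this
  simpa [vact_one, add_comm] using this

theorem inl_pow (w : Fin 2 → ZMod m) (n : ℕ) :
    (SemidirectProduct.inl (Multiplicative.ofAdd w) : SLProd η) ^ n =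
      SemidirectProduct.inl (Multiplicative.ofAdd (n • w)) := by
  rw [← map_pow, ofAdd_nsmul]

theorem eq_inl_of_pow_eq_one {n : ℕ} (hn : n.Coprime k) {g : SLProd η} (hg : g ^ n = 1) :
    ∃ w, g = SemidirectProduct.inl (Multiplicative.ofAdd w) ∧ n • w = 0 := by
  have hr : g.right = 1 := by
    have h1 : g.right ^ n = 1 := 
      (map_pow SemidirectProduct.rightHom g n).symm.trans (congrArg SemidirectProduct.right hg)
    have := (pow_gcd_eq_one (a := g.right)).2 ⟨h1, cc_pow_eq_one g.right⟩
    rwa [hn.gcd_eq_one, pow_one] at this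
  have hgl : g = SemidirectProduct.inl (Multiplicative.ofAdd g.left.toAdd) :=
    SemidirectProduct.ext rfl (by rw [hr]; rfl)
  refine ⟨_, hgl, ?_⟩
  rw [hgl, inl_pow] at hg
  have := SemidirectProduct.inl_injective (hg.trans (map_one SemidirectProduct.inl).symm)
  exact congrArg Multiplicative.toAdd this

/-- The image of the complement under a homomorphism is conjugate into the complement, by the
average of the vector parts. -/
theorem exists_conj_eq_inr [NeZero k] (hk : k.Coprime m) (ψ : CC k →* SLProd η) :
    ∃ t : SLProd η, ∀ q, t * ψ q * t⁻¹ = SemidirectProduct.inr (ψ q).right := by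
  set x := ((k * k : ℕ) : ZMod m)⁻¹ • ∑ q : CC k, (ψ q).left.toAdd with hx
  have hxq (q : CC k) : vact η (ψ q).right x = x - (ψ q).left.toAdd := by
    -- The vector part of a homomorphism is a crossed homomorphism.
    have h1 (q' : CC k) : vact η (ψ q).right (ψ q').left.toAdd =
        (ψ (q * q')).left.toAdd - (ψ q).left.toAdd := by
      rw [map_mul, slprod_mul_left, add_sub_cancel_left]
    rw [hx, map_smul, map_sum, Finset.sum_congr rfl fun q' _ => h1 q', Finset.sum_sub_distrib,
      Finset.sum_const, Finset.card_univ, Fintype.card_prod, Fintype.card_multiplicative,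
      ZMod.card, smul_sub, ← Nat.cast_smul_eq_nsmul (ZMod m), smul_smul, mul_comm _⁻¹,
      ZMod.coe_mul_inv_eq_one _ (hk.mul_left hk), one_smul]
    congr 2
    exact Fintype.sum_equiv (Equiv.mulLeft q) _ _ fun _ => rfl
  refine ⟨(SemidirectProduct.inl (Multiplicative.ofAdd x))⁻¹, fun q => ?_⟩
  rw [inv_inv]
  refine SemidirectProduct.ext ?_ ?_
  · apply Multiplicative.toAdd.injective
    rw [slprod_mul_left, ← map_inv, slprod_mul_left]
    simp only [SemidirectProduct.left_inl, SemidirectProduct.right_inl, vact_one,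
      SemidirectProduct.mul_right, one_mul, toAdd_ofAdd, toAdd_inv, hxq,
      SemidirectProduct.left_inr, toAdd_one]
    abel
  · simp

variable {p : Fin 3 → ℕ} (η : CC k →* SpecialLinearGroup (Fin 2) (ZMod (∏ j, p j)))

/-- A group-theoretic description of the preimage of the kernel of the `i`-th component, which
shows that it is preserved by automorphisms. -/
theorem right_mem_ker_iff (hp : ∀ i, p i ≠ 0) (hk : ∀ i, (p i).Coprime k) (i : Fin 3)
    (g : SLProd η) :
    g.right ∈ ((slComponent p i).comp η).ker ↔ ∀ h : SLProd η, h ^ p i = 1 → Commute g h := by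
  rw [mem_ker_slComponent_iff η hp]
  constructor
  · intro hg h hh
    obtain ⟨w, rfl, hw⟩ := eq_inl_of_pow_eq_one η (hk i) hh
    exact commute_inl η (hg w hw)
  · intro hg v hv
    refine (commute_inl_iff η).1 (hg _ ?_)
    rw [inl_pow, hv, ofAdd_zero, map_one]

theorem right_mem_ker_of_mem (hp : ∀ i, p i ≠ 0) (hk : ∀ i, (p i).Coprime k) (i : Fin 3)
    (ψ : MulAut (SLProd η)) {q : CC k} (hq : q ∈ ((slComponent p i).comp η).ker) :
    (ψ (SemidirectProduct.inr q)).right ∈ ((slComponent p i).comp η).ker := by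
  rw [right_mem_ker_iff η hp hk]
  intro h hh
  have h1 : Commute (SemidirectProduct.inr q : SLProd η) (ψ⁻¹ h) := by
    refine (right_mem_ker_iff η hp hk i _).1 hq _ ?_
    rw [← map_pow, hh, map_one]
  have := h1.map ψ
  rwa [MulAut.apply_inv_self] at this

/-- An automorphism preserves each of the three kernels, so modulo the vectors it acts on
`C_k × C_k` as a power map `q ↦ q ^ j`, which raises the values of the form to the power `j ^ 2`. -/
theorem exists_form_eq_pow_sq (hkp : k.Prime) (hp : ∀ i, p i ≠ 0) (hk : ∀ i, (p i).Coprime k)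
    (hη : HasKernels p k η) {c c' : H2C (SLProd η)} (h : SameOrbit c c') :
    ∃ j : ℕ, 1 ≤ j ∧ j ≤ k - 1 ∧
      form c' (SemidirectProduct.inr (CC.x k)) (SemidirectProduct.inr (CC.y k)) =
        form c (SemidirectProduct.inr (CC.x k)) (SemidirectProduct.inr (CC.y k)) ^ j ^ 2 := by
  have := NeZero.mk hkp.ne_zero
  have : NeZero (∏ j, p j) := ⟨Finset.prod_ne_zero_iff.2 fun j _ => hp j⟩
  have hkm : k.Coprime (∏ j, p j) := Nat.Coprime.prod_right fun i _ => (hk i).symm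
  obtain ⟨φ, rfl⟩ := h
  set ψ : MulAut (SLProd η) := φ⁻¹ with hψ
  obtain ⟨h0, h1, h2⟩ := hη
  have hx : (ψ (SemidirectProduct.inr (CC.x k))).right ∈ Subgroup.zpowers (CC.x k) := by
    rw [← h0]
    refine right_mem_ker_of_mem η hp hk 0 ψ ?_
    rw [h0]
    exact Subgroup.mem_zpowers _
  have hy : (ψ (SemidirectProduct.inr (CC.y k))).right ∈ Subgroup.zpowers (CC.y k) := by
    rw [← h1]
    refine right_mem_ker_of_mem η hp hk 1 ψ ?_
    rw [h1]
    exact Subgroup.mem_zpowers _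
  have hxy : (ψ (SemidirectProduct.inr (CC.x k * CC.y k))).right ∈
      Subgroup.zpowers (CC.x k * CC.y k) := by
    rw [← h2]
    refine right_mem_ker_of_mem η hp hk 2 ψ ?_
    rw [h2]
    exact Subgroup.mem_zpowers _
  obtain ⟨a, ha⟩ := Subgroup.mem_zpowers_iff.1 hx
  obtain ⟨b, hb⟩ := Subgroup.mem_zpowers_iff.1 hy
  obtain ⟨d, hd⟩ := Subgroup.mem_zpowers_iff.1 hxy
  rw [map_mul, map_mul, SemidirectProduct.mul_right, ← ha, ← hb] at hd
  -- The images of `x`, `y` and `x y` are `x ^ a`, `y ^ b` and `(x y) ^ d`, so `a`, `b`, `d` agree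
  -- modulo `k`.
  have had : (d : ZMod k) = a := by
    simpa [CC.x, CC.y] using congrArg (fun q : CC k => q.1.toAdd) hd
  have hbd : (d : ZMod k) = b := by
    simpa [CC.x, CC.y] using congrArg (fun q : CC k => q.2.toAdd) hd
  set j := (d : ZMod k).val with hj
  have hxj : (ψ (SemidirectProduct.inr (CC.x k))).right = CC.x k ^ j := by
    rw [← ha]
    refine Prod.ext (Multiplicative.toAdd.injective ?_) (by simp [CC.x])
    simp [CC.x, hj, had]
  have hyj : (ψ (SemidirectProduct.inr (CC.y k))).right = CC.y k ^ j := by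
    rw [← hb]
    refine Prod.ext (by simp [CC.y]) (Multiplicative.toAdd.injective ?_)
    simp [CC.y, hj, hbd]
  obtain ⟨t, ht⟩ := exists_conj_eq_inr η hkm
    ((ψ : SLProd η ≃* SLProd η).toMonoidHom.comp SemidirectProduct.inr)
  have hc : Commute (CC.x k) (CC.y k) := Commute.all _ _
  have hc' : Commute (SemidirectProduct.inr (CC.x k) : SLProd η)
    (SemidirectProduct.inr (CC.y k)) := hc.map SemidirectProduct.inr
  have hcψ := hc'.map ψ
  have htx := ht (CC.x k)
  have hty := ht (CC.y k)
  simp only [MonoidHom.comp_apply, MulEquiv.toMonoidHom_eq_coe, MonoidHom.coe_coe] at htx hty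
  rw [hxj] at htx
  rw [hyj] at hty
  have hj0 : j ≠ 0 := by
    intro h0
    rw [h0, pow_zero, map_one, mul_inv_eq_one, mul_eq_left] at htx
    have h3 : (SemidirectProduct.inr (CC.x k) : SLProd η) = 1 :=
      (map_eq_one_iff ψ ψ.injective).1 htx
    have h4 : CC.x k = 1 := SemidirectProduct.inr_injective (h3.trans (map_one _).symm)
    have h5 : (1 : ZMod k) = 0 := congrArg (fun q : CC k => q.1.toAdd) h4
    have := Fact.mk hkp
    exact one_ne_zero h5
  refine ⟨j, Nat.one_le_iff_ne_zero.2 hj0, Nat.le_sub_one_of_lt (ZMod.val_lt _), ?_⟩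
  rw [autAct, form_pull _ _ hc']
  show form c (ψ _) (ψ _) = _
  rw [← form_conj c hcψ t, htx, hty, map_pow, map_pow,
    form_pow_left c (hc'.pow_right j), form_pow_right c hc', ← pow_mul, sq]

end Orbits

section CubeFree

/-- If orbits change the value `α(x, y)` only by exponents `j ^ 2`, then `ξ` and its power with a
non-square exponent belong to different orbits. -/
theorem not_autTransitive_of_pow_sq {k : ℕ} (hk : k.Prime) (hodd : Odd k) {G : Type} [Group G]
    {x y : G} (hex : ∀ ξ : ℂˣ, IsPrimitiveRoot ξ k → ∃ c : H2C G, Nondeg c ∧ form c x y = ξ)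
    (horb : ∀ c c' : H2C G, SameOrbit c c' → ∃ j : ℕ, form c' x y = form c x y ^ j ^ 2) :
    ¬ AutTransitive G := by
  intro htrans
  have := Fact.mk hk
  obtain ⟨n, hn⟩ := FiniteField.exists_nonsquare (F := ZMod k) (by
    rw [ZMod.ringChar_zmod_n]
    rintro rfl
    exact absurd hodd (by decide))
  obtain ⟨ξ, hξ⟩ := exists_isPrimitiveRoot_units k hk.ne_zero
  have hn0 : n ≠ 0 := by
    rintro rfl
    exact hn (IsSquare.zero)
  have hcop : n.val.Coprime k := by
    refine ((Nat.Prime.coprime_iff_not_dvd hk).2 fun h => hn0 ?_).symm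
    exact (ZMod.val_eq_zero n).1 (Nat.eq_zero_of_dvd_of_lt h n.val_lt)
  obtain ⟨c, hc, hcξ⟩ := hex ξ hξ
  obtain ⟨c', hc', hcξ'⟩ := hex (ξ ^ n.val) (hξ.pow_of_coprime _ hcop)
  obtain ⟨j, hj⟩ := horb c c' (htrans c c' hc hc')
  rw [hcξ, hcξ'] at hj
  have hj' := (pow_eq_pow_iff_modEq).1 hj
  rw [← hξ.eq_orderOf] at hj'
  have := (ZMod.natCast_eq_natCast_iff _ _ _).2 hj'
  refine hn ⟨(j : ZMod k), ?_⟩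
  rw [← ZMod.natCast_zmod_val n, this]
  push_cast
  ring

theorem cubeFree_case (k : ℕ) (p : Fin 3 → ℕ) (hk : k.Prime) (hodd : Odd k)
    (hp : ∀ i, (p i).Prime) (hinj : Function.Injective p)
    (hpk : ∀ i, (p i : ℤ) ≡ 1 [ZMOD k] ∨ (p i : ℤ) ≡ -1 [ZMOD k]) :
    (∃ η, HasKernels p k η) ∧
      ∀ η, HasKernels p k η →
        Nat.card (SLProd η) = ((∏ i, p i) * k) ^ 2 ∧
        (∀ r : ℕ, r.Prime → ¬ r ^ 3 ∣ Nat.card (SLProd η)) ∧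
        IsCentralType (SLProd η) ∧
        ¬ AutTransitive (SLProd η) ∧
        (∀ ξ : ℂˣ, IsPrimitiveRoot ξ k → ∃ c : H2C (SLProd η), Nondeg c ∧
          form c (SemidirectProduct.inr (CC.x k)) (SemidirectProduct.inr (CC.y k)) = ξ) ∧
        (∀ c c' : H2C (SLProd η), SameOrbit c c' → ∃ j : ℕ, 1 ≤ j ∧ j ≤ k - 1 ∧
          form c' (SemidirectProduct.inr (CC.x k)) (SemidirectProduct.inr (CC.y k)) =
            form c (SemidirectProduct.inr (CC.x k)) (SemidirectProduct.inr (CC.y k)) ^ j ^ 2) := by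
  refine ⟨exists_hasKernels hk hp hinj hpk, fun η hη => ?_⟩
  have hp0 (i) : p i ≠ 0 := (hp i).ne_zero
  have := NeZero.mk hk.ne_zero
  have : NeZero (∏ j, p j) := ⟨Finset.prod_ne_zero_iff.2 fun j _ => hp0 j⟩
  have hcop (i) : (p i).Coprime k := by
    refine (Nat.coprime_primes (hp i) hk).2 fun h => ?_
    have hi := hpk i
    rw [h] at hi
    have hd : (k : ℤ) ∣ 1 := by
      rcases hi with hi | hi
      · simpa using dvd_sub (dvd_refl (k : ℤ)) hi.symm.dvd
      · simpa using dvd_sub hi.symm.dvd (dvd_refl (k : ℤ))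
    exact hk.one_lt.ne' (Nat.dvd_one.1 (by exact_mod_cast hd))
  have hkm : k.Coprime (∏ j, p j) := Nat.Coprime.prod_right fun i _ => (hcop i).symm
  have hcard : Nat.card (SLProd η) = ((∏ i, p i) * k) ^ 2 := by
    rw [SemidirectProduct.card]
    simp [sq, mul_mul_mul_comm]
  have hex (ξ : ℂˣ) (hξ : IsPrimitiveRoot ξ k) : ∃ c : H2C (SLProd η), Nondeg c ∧
      form c (SemidirectProduct.inr (CC.x k)) (SemidirectProduct.inr (CC.y k)) = ξ :=
    exists_nondeg_slprod hkm η hξ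
  have horb (c c' : H2C (SLProd η)) (h : SameOrbit c c') :=
    exists_form_eq_pow_sq η hk hp0 hcop hη h
  refine ⟨hcard, fun r hr hdvd => ?_, ?_, ?_, hex, horb⟩
  · rw [hcard] at hdvd
    have hsq : Squarefree ((∏ i, p i) * k) := by
      rw [Nat.squarefree_mul hkm.symm]
      refine ⟨Finset.squarefree_prod_of_pairwise_isCoprime ?_ fun i _ => (hp i).squarefree,
        hk.squarefree⟩
      intro i _ j _ hij
      exact Nat.coprime_iff_isRelPrime.1
        ((Nat.coprime_primes (hp i) (hp j)).2 (hinj.ne hij))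
    have hn := NeZero.ne (∏ j, p j)
    have h1 := (hr.pow_dvd_iff_le_factorization
      (pow_ne_zero 2 (mul_ne_zero hn hk.ne_zero))).1 hdvd
    have h2 := hsq.natFactorization_le_one r
    rw [Nat.factorization_pow, Finsupp.smul_apply, smul_eq_mul] at h1
    omega
  · obtain ⟨ξ, hξ⟩ := exists_isPrimitiveRoot_units k hk.ne_zero
    obtain ⟨c, hc, -⟩ := hex ξ hξ
    exact ⟨c, hc⟩
  · refine not_autTransitive_of_pow_sq hk hodd hex fun c c' h => ?_
    obtain ⟨j, -, -, hj⟩ := horb c c' h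
    exact ⟨j, hj⟩

end CubeFree

/-! ### Diagonal actions and Sylow subgroups -/

section VecForms

/-- Every alternating form on `C_n × C_n` is a character of the determinant. -/
theorem exists_form_eq_det2 {n : ℕ} [NeZero n] (d : H2C (Vec n)) :
    ∃ χ : AddChar (ZMod n) ℂˣ, ∀ v w : Vec n, form d v w = χ (det2 w.toAdd v.toAdd) := by
  let e (i : Fin 2) : Vec n := Multiplicative.ofAdd (Pi.single i 1)
  have he (i : Fin 2) : e i ^ n = 1 := by
    apply Multiplicative.toAdd.injective
    ext j
    simp
  have hω : form d (e 1) (e 0) ^ n = 1 := by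
    rw [← form_pow_left d (Commute.all _ _), he, form_one_left]
  refine ⟨AddChar.zmodChar n hω, fun v w => ?_⟩
  have hv (v : Vec n) : v = e 0 ^ (v.toAdd 0).val * e 1 ^ (v.toAdd 1).val := by
    apply Multiplicative.toAdd.injective
    ext j
    show v.toAdd j = (v.toAdd 0).val • (Pi.single 0 1 : Fin 2 → ZMod n) j +
      (v.toAdd 1).val • (Pi.single 1 1 : Fin 2 → ZMod n) j
    fin_cases j <;> simp
  have hχ (a b : ZMod n) : AddChar.zmodChar n hω (a * b) =
      form d (e 1) (e 0) ^ (a.val * b.val) := by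
    rw [← AddChar.zmodChar_apply' hω]
    simp
  conv_lhs => rw [hv v, hv w]
  simp only [form_mul_left d (Commute.all _ _) (Commute.all _ _),
    form_mul_right d (Commute.all _ _) (Commute.all _ _), form_pow_left d (Commute.all _ _),
    form_pow_right d (Commute.all _ _), form_self, one_pow, one_mul, mul_one]
  rw [form_symm d (Commute.all (e 1) (e 0)), det2, AddChar.map_sub_eq_div, hχ, hχ, ← pow_mul,
    ← pow_mul, inv_pow, div_eq_mul_inv]
  rw [mul_comm, mul_comm (w.toAdd 1).val]

end VecForms

section Squarefree

/-- Elements of `r`-power order in a group of squarefree exponent have order dividing `r`. -/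
theorem pow_eq_one_of_squarefree {G : Type} [Group G] {N r i : ℕ} (hr : r.Prime)
    (hN : Squarefree N) {g : G} (hg : g ^ N = 1) (hgr : g ^ r ^ i = 1) : g ^ r = 1 := by
  obtain ⟨j, -, hj⟩ := (Nat.dvd_prime_pow hr).1 (orderOf_dvd_of_pow_eq_one hgr)
  have hsq : Squarefree (r ^ j) := hj ▸ hN.squarefree_of_dvd (orderOf_dvd_of_pow_eq_one hg)
  refine orderOf_dvd_iff_pow_eq_one.1 ?_
  rw [hj]
  rcases Nat.lt_or_ge j 2 with h | h
  · exact (pow_dvd_pow r (Nat.le_of_lt_succ h)).trans (by simp)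
  · exact absurd (hsq r ((sq r ▸ pow_dvd_pow r h))) (Nat.isUnit_iff.not.2 hr.one_lt.ne')

/-- In an extension of abelian groups of coprime exponents, `k` prime, the Sylow subgroups are
abelian. -/
theorem sylow_comm {G Q : Type} [Group G] [CommGroup Q] (π : G →* Q) {k E r : ℕ}
    (hk : k.Prime) (hr : r.Prime) (hkE : k.Coprime E) (hQ : ∀ q : Q, q ^ k = 1)
    (hker : ∀ g h, π g = 1 → π h = 1 → g * h = h * g) (hE : ∀ g, π g = 1 → g ^ E = 1)
    (P : Sylow r G) (a b : G) (ha : a ∈ P) (hb : b ∈ P) : a * b = b * a := by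
  have hpow (g : G) (hg : g ∈ P) : ∃ i, g ^ r ^ i = 1 := by
    obtain ⟨i, hi⟩ := P.isPGroup' ⟨g, hg⟩
    exact ⟨i, congrArg Subtype.val hi⟩
  have hone {x : G} {y z : ℕ} (hy : x ^ y = 1) (hz : x ^ z = 1) (hyz : y.Coprime z) : x = 1 := by
    have := pow_gcd_eq_one.2 ⟨hy, hz⟩
    rwa [hyz.gcd_eq_one, pow_one] at this
  by_cases hrk : r = k
  · subst hrk
    have hc : a * b * a⁻¹ * b⁻¹ ∈ P :=
      P.mul_mem (P.mul_mem (P.mul_mem ha hb) (P.inv_mem ha)) (P.inv_mem hb)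
    obtain ⟨i, hi⟩ := hpow _ hc
    -- A commutator lies in the kernel of `π`, where there are no `k`-elements.
    have h1 : a * b * a⁻¹ * b⁻¹ = 1 := by
      refine hone hi (hE _ ?_) (hkE.pow_left i)
      simp only [map_mul, map_inv]
      rw [mul_comm (π a), mul_inv_cancel_right, mul_inv_cancel]
    rwa [mul_inv_eq_one, mul_inv_eq_iff_eq_mul] at h1
  · have hπ (g : G) (hg : g ∈ P) : π g = 1 := by
      obtain ⟨i, hi⟩ := hpow g hg
      have h1 : π g ^ r ^ i = 1 := by rw [← map_pow, hi, map_one]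
      have := pow_gcd_eq_one.2 ⟨h1, hQ (π g)⟩
      rwa [(((Nat.coprime_primes hr hk).2 hrk).pow_left i).gcd_eq_one, pow_one] at this
    exact hker a b (hπ a ha) (hπ b hb)

end Squarefree

section Diagonal

variable {q k : ℕ} {a b : ℤ}

theorem exists_isDiagAction (hk : k.Prime) (hab : a * b ≡ 1 [ZMOD q]) (hak : a ^ k ≡ 1 [ZMOD q]) :
    ∃ η, IsDiagAction q k a b η := by
  have := NeZero.mk hk.ne_zero
  have hab' : (a : ZMod q) * b = 1 := by exact_mod_cast (ZMod.intCast_eq_intCast_iff _ _ _).2 hab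
  have hak' : (a : ZMod q) ^ k = 1 := by exact_mod_cast (ZMod.intCast_eq_intCast_iff _ _ _).2 hak
  have hbk' : (b : ZMod q) ^ k = 1 := by
    have := congrArg (· ^ k) hab'
    simpa [mul_pow, hak'] using this
  let D : SpecialLinearGroup (Fin 2) (ZMod q) :=
    ⟨!![(a : ZMod q), 0; 0, (b : ZMod q)], by simp [Matrix.det_fin_two, hab']⟩
  have hpow (n : ℕ) : (D ^ n).1 = !![(a : ZMod q) ^ n, 0; 0, (b : ZMod q) ^ n] := by
    induction n with
    | zero => rw [pow_zero, pow_zero, pow_zero]; exact Matrix.one_fin_two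
    | succ n ih =>
      rw [pow_succ, pow_succ, pow_succ]
      have : (D ^ n * D).1 = (D ^ n).1 * D.1 := rfl
      rw [this, ih]
      simp [D]
  have hD : D ^ k = 1 := by
    apply Subtype.ext
    rw [hpow, hak', hbk']
    exact Matrix.one_fin_two.symm
  refine ⟨(powHom hD).comp (MonoidHom.fst _ _), ?_, ?_⟩
  · have h1 : ((powHom hD).comp (MonoidHom.fst _ _)) (CC.x k) = D := by
      show D ^ (1 : ZMod k).val = D
      have := Fact.mk hk.one_lt
      rw [ZMod.val_one, pow_one]
    rw [h1]
  · exact (powHom hD).map_one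

variable (η : CC k →* SpecialLinearGroup (Fin 2) (ZMod q))

theorem cc_eq_mul [NeZero k] (g : CC k) :
    g = CC.x k ^ g.1.toAdd.val * CC.y k ^ g.2.toAdd.val := by
  refine Prod.ext ?_ ?_ <;> apply Multiplicative.toAdd.injective <;> simp [CC.x, CC.y]

variable {η}

theorem IsDiagAction.vact_apply_eq [NeZero k] (hη : IsDiagAction q k a b η) (g : CC k)
    (v : Fin 2 → ZMod q) :
    vact η g v = ![(a : ZMod q) ^ g.1.toAdd.val * v 0, (b : ZMod q) ^ g.1.toAdd.val * v 1] := by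
  have hx (v : Fin 2 → ZMod q) : vact η (CC.x k) v = ![(a : ZMod q) * v 0, (b : ZMod q) * v 1] := by
    rw [vact_apply, hη.1]
    ext i
    fin_cases i <;> simp [Matrix.mulVec, dotProduct, Fin.sum_univ_two]
  have hy : vact η (CC.y k ^ g.2.toAdd.val) v = v := by
    rw [vact_apply, map_pow, hη.2, one_pow]
    exact Matrix.one_mulVec v
  have hxn (n : ℕ) : vact η (CC.x k ^ n) v =
      ![(a : ZMod q) ^ n * v 0, (b : ZMod q) ^ n * v 1] := by
    induction n with
    | zero =>
      ext i
      fin_cases i <;> simp [vact_one]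
    | succ n ih =>
      rw [pow_succ', vact_mul, ih, hx]
      ext i
      fin_cases i <;> simp [pow_succ', mul_assoc]
  conv_lhs => rw [cc_eq_mul g]
  rw [vact_mul, hy, hxn]

/-- The centre of `(ℤ/q)² ⋊ (⟨σ⟩ × ⟨τ⟩)` is `⟨τ⟩`, because `σ` has no nonzero fixed vector. -/
theorem IsDiagAction.mem_center_iff (hη : IsDiagAction q k a b η) (hq : q.Prime) (hk : k.Prime)
    (hab : a * b ≡ 1 [ZMOD q]) (hak : a ^ k ≡ 1 [ZMOD q]) (ha : ¬ a ≡ 1 [ZMOD q])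
    (g : SLProd η) :
    g ∈ Subgroup.center (SLProd η) ↔ ∃ r : CC k, r.1 = 1 ∧ g = SemidirectProduct.inr r := by
  have := NeZero.mk hk.ne_zero
  have := Fact.mk hq
  have := Fact.mk hk
  have hab' : (a : ZMod q) * b = 1 := by exact_mod_cast (ZMod.intCast_eq_intCast_iff _ _ _).2 hab
  have hak' : (a : ZMod q) ^ k = 1 := by exact_mod_cast (ZMod.intCast_eq_intCast_iff _ _ _).2 hak
  have ha' : (a : ZMod q) ≠ 1 := fun h =>
    ha ((ZMod.intCast_eq_intCast_iff _ _ _).1 (by exact_mod_cast h))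
  have hb' : (b : ZMod q) ≠ 1 := fun h => ha' (by rwa [h, mul_one] at hab')
  rw [Subgroup.mem_center_iff]
  constructor
  · intro hg
    have h1 := hg (SemidirectProduct.inr (CC.x k))
    have hv : vact η (CC.x k) g.left.toAdd = g.left.toAdd := by
      have := congrArg (fun x => Multiplicative.toAdd (SemidirectProduct.left x)) h1
      simpa only [slprod_mul_left, SemidirectProduct.left_inr, SemidirectProduct.right_inr,
        toAdd_one, map_zero, add_zero, zero_add] using this
    have hx1 : Multiplicative.toAdd (CC.x k).1 = 1 := rfl
    rw [hη.vact_apply_eq, hx1, ZMod.val_one, pow_one, pow_one] at hv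
    have hv0 : g.left.toAdd = 0 := by
      ext i
      have := congrFun hv i
      fin_cases i
      · exact (mul_left_eq_self₀.1 this).resolve_left ha'
      · exact (mul_left_eq_self₀.1 this).resolve_left hb'
    have h2 := (commute_inl_iff η (g := g) (w := ![1, 0])).1 (hg _).symm
    rw [hη.vact_apply_eq] at h2
    have h3 : (a : ZMod q) ^ g.right.1.toAdd.val = 1 := by
      simpa using congrFun h2 0
    refine ⟨g.right, ?_, SemidirectProduct.ext hv0 rfl⟩
    apply Multiplicative.toAdd.injective
    rw [toAdd_one, ← ZMod.val_eq_zero]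
    by_contra h0
    have hc : Nat.Coprime g.right.1.toAdd.val k :=
      (Nat.coprime_of_lt_prime h0 (ZMod.val_lt _) hk).symm
    have := pow_gcd_eq_one.2 ⟨h3, hak'⟩
    rw [hc.gcd_eq_one, pow_one] at this
    exact ha' this
  · rintro ⟨r, hr, rfl⟩ h
    refine SemidirectProduct.ext ?_ ?_
    · apply Multiplicative.toAdd.injective
      rw [slprod_mul_left, slprod_mul_left]
      simp only [SemidirectProduct.left_inr, SemidirectProduct.right_inr, toAdd_one, map_zero,
        add_zero, zero_add]
      rw [hη.vact_apply_eq, hr]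
      ext i
      fin_cases i <;> simp
    · simp [mul_comm]

end Diagonal

/-! ### Direct products of A-type -/

section Complement

/-- The cocycle `ψ ∘ L` for a biadditive function `L` to `ℤ/k`. -/
noncomputable def expZ2 {Q : Type} [Group Q] {k : ℕ} (ψ : AddChar (ZMod k) ℂˣ) (L : Q → Q → ZMod k)
    (hl : ∀ a b c, L (a * b) c = L a c + L b c) (hr : ∀ a b c, L a (b * c) = L a b + L a c) :
    Z2C Q :=
  bimulZ2 (fun q q' => ψ (L q q')) (fun a b c => by rw [hl, AddChar.map_add_eq_mul])
    (fun a b c => by rw [hr, AddChar.map_add_eq_mul])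

theorem form_expZ2 {Q : Type} [CommGroup Q] {k : ℕ} (ψ : AddChar (ZMod k) ℂˣ) (L : Q → Q → ZMod k)
    (hl hr) (q q' : Q) : form (cls (expZ2 ψ L hl hr)) q q' = ψ (L q' q - L q q') := by
  rw [form_cls' _ (Commute.all q q'), AddChar.map_sub_eq_div, div_eq_mul_inv]
  rfl

variable {k : ℕ} [NeZero k]

/-- The class on `⟨σ₁, τ₁⟩ × ⟨σ₂, τ₂⟩` whose form pairs `τ_i` with `σ_i`. -/
noncomputable def splitClass (ψ : AddChar (ZMod k) ℂˣ) : H2C (CC k × CC k) :=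
  cls (expZ2 ψ (fun q q' => q.1.1.toAdd * q'.1.2.toAdd + q.2.1.toAdd * q'.2.2.toAdd)
    (fun a b c => by simp only [Prod.fst_mul, Prod.snd_mul, toAdd_mul]; ring)
    (fun a b c => by simp only [Prod.fst_mul, Prod.snd_mul, toAdd_mul]; ring))

/-- The class on `⟨σ₁, τ₁⟩ × ⟨σ₂, τ₂⟩` whose form pairs `τ₁` with `τ₂` and `σ₁` with `σ₂`. -/
noncomputable def crossClass (ψ : AddChar (ZMod k) ℂˣ) : H2C (CC k × CC k) :=
  cls (expZ2 ψ (fun q q' => q.2.2.toAdd * q'.1.2.toAdd + q.2.1.toAdd * q'.1.1.toAdd)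
    (fun a b c => by simp only [Prod.fst_mul, Prod.snd_mul, toAdd_mul]; ring)
    (fun a b c => by simp only [Prod.fst_mul, Prod.snd_mul, toAdd_mul]; ring))

omit [NeZero k] in
theorem form_splitClass (ψ : AddChar (ZMod k) ℂˣ) (q q' : CC k × CC k) :
    form (splitClass ψ) q q' =
      ψ (q'.1.1.toAdd * q.1.2.toAdd + q'.2.1.toAdd * q.2.2.toAdd -
        (q.1.1.toAdd * q'.1.2.toAdd + q.2.1.toAdd * q'.2.2.toAdd)) := form_expZ2 _ _ _ _ _ _

omit [NeZero k] in
theorem form_crossClass (ψ : AddChar (ZMod k) ℂˣ) (q q' : CC k × CC k) :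
    form (crossClass ψ) q q' =
      ψ (q'.2.2.toAdd * q.1.2.toAdd + q'.2.1.toAdd * q.1.1.toAdd -
        (q.2.2.toAdd * q'.1.2.toAdd + q.2.1.toAdd * q'.1.1.toAdd)) := form_expZ2 _ _ _ _ _ _

omit [NeZero k] in
theorem eq_one_of_toAdd {q : CC k × CC k} (h1 : q.1.1.toAdd = 0) (h2 : q.1.2.toAdd = 0)
    (h3 : q.2.1.toAdd = 0) (h4 : q.2.2.toAdd = 0) : q = 1 :=
  Prod.ext (Prod.ext h1 h2) (Prod.ext h3 h4)

theorem nondeg_splitClass {ψ : AddChar (ZMod k) ℂˣ} (hψ : ∀ a, ψ a = 1 ↔ a = 0) :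
    Nondeg (splitClass ψ) := by
  refine (nondeg_iff _).2 fun q hq => ?_
  by_contra! hcon
  have h (q') := hcon q' (Commute.all _ _)
  simp only [form_splitClass, hψ] at h
  refine hq (eq_one_of_toAdd ?_ ?_ ?_ ?_)
  · simpa [CC.y] using h (CC.y k, 1)
  · simpa [CC.x] using h (CC.x k, 1)
  · simpa [CC.y] using h (1, CC.y k)
  · simpa [CC.x] using h (1, CC.x k)

theorem nondeg_crossClass {ψ : AddChar (ZMod k) ℂˣ} (hψ : ∀ a, ψ a = 1 ↔ a = 0) :
    Nondeg (crossClass ψ) := by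
  refine (nondeg_iff _).2 fun q hq => ?_
  by_contra! hcon
  have h (q') := hcon q' (Commute.all _ _)
  simp only [form_crossClass, hψ] at h
  refine hq (eq_one_of_toAdd ?_ ?_ ?_ ?_)
  · simpa [CC.x] using h (1, CC.x k)
  · simpa [CC.y] using h (1, CC.y k)
  · simpa [CC.x] using h (CC.x k, 1)
  · simpa [CC.y] using h (CC.y k, 1)

end Complement

section VecProd

variable {q₁ q₂ : ℕ} [NeZero q₁] [NeZero q₂]

/-- A class on `(ℤ/q₁)² × (ℤ/q₂)²` whose form is an orthogonal sum of primitive characters of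
determinants is non-degenerate. -/
theorem nondeg_of_form_det2 {χ₁ : AddChar (ZMod q₁) ℂˣ} {χ₂ : AddChar (ZMod q₂) ℂˣ}
    (h₁ : χ₁.IsPrimitive) (h₂ : χ₂.IsPrimitive) {d : H2C (Vec q₁ × Vec q₂)}
    (hd : ∀ v w, form d v w =
      χ₁ (det2 w.1.toAdd v.1.toAdd) * χ₂ (det2 w.2.toAdd v.2.toAdd)) : Nondeg d := by
  refine (nondeg_iff _).2 fun v hv => ?_
  by_cases hv1 : v.1.toAdd = 0
  · have hv2 : v.2.toAdd ≠ 0 := fun h => hv (Prod.ext hv1 h)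
    obtain ⟨w, hw⟩ := exists_det2_ne_one h₂ hv2
    refine ⟨(1, Multiplicative.ofAdd w), Commute.all _ _, ?_⟩
    rw [hd, hv1]
    simpa [det2] using hw
  · obtain ⟨w, hw⟩ := exists_det2_ne_one h₁ hv1
    refine ⟨(Multiplicative.ofAdd w, 1), Commute.all _ _, ?_⟩
    rw [hd]
    simpa [det2] using hw

theorem vec_pow_eq_one {q : ℕ} (v : Vec q) : v ^ q = 1 := by
  apply Multiplicative.toAdd.injective
  ext j
  simp

/-- For distinct primes the form of every non-degenerate class on `(ℤ/q₁)² × (ℤ/q₂)²` is an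
orthogonal sum of primitive characters of determinants. -/
theorem exists_form_eq_of_nondeg (hq₁ : q₁.Prime) (hq₂ : q₂.Prime) (hne : q₁ ≠ q₂)
    {d : H2C (Vec q₁ × Vec q₂)} (hd : Nondeg d) :
    ∃ (χ₁ : AddChar (ZMod q₁) ℂˣ) (χ₂ : AddChar (ZMod q₂) ℂˣ), χ₁.IsPrimitive ∧ χ₂.IsPrimitive ∧
      ∀ v w, form d v w = χ₁ (det2 w.1.toAdd v.1.toAdd) * χ₂ (det2 w.2.toAdd v.2.toAdd) := by
  have := Fact.mk hq₁
  have := Fact.mk hq₂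
  obtain ⟨χ₁, h₁⟩ := exists_form_eq_det2 (pull (MonoidHom.inl (Vec q₁) (Vec q₂)) d)
  obtain ⟨χ₂, h₂⟩ := exists_form_eq_det2 (pull (MonoidHom.inr (Vec q₁) (Vec q₂)) d)
  replace h₁ (v w : Vec q₁) : form d (v, 1) (w, 1) = χ₁ (det2 w.toAdd v.toAdd) := by
    rw [← h₁, form_pull _ _ (Commute.all v w)]
    rfl
  replace h₂ (v w : Vec q₂) : form d (1, v) (1, w) = χ₂ (det2 w.toAdd v.toAdd) := by
    rw [← h₂, form_pull _ _ (Commute.all v w)]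
    rfl
  -- The two factors have coprime exponents.
  have cross (v : Vec q₁) (w : Vec q₂) : form d (v, 1) (1, w) = 1 := by
    have e1 : form d (v, 1) (1, w) ^ q₁ = 1 := by
      rw [← form_pow_left d (Commute.all _ _), Prod.pow_mk, vec_pow_eq_one, one_pow]
      exact form_one_left d _
    have e2 : form d (v, 1) (1, w) ^ q₂ = 1 := by
      rw [← form_pow_right d (Commute.all _ _), Prod.pow_mk, vec_pow_eq_one, one_pow]
      exact form_one_right d _
    have := pow_gcd_eq_one.2 ⟨e1, e2⟩
    rwa [((Nat.coprime_primes hq₁ hq₂).2 hne).gcd_eq_one, pow_one] at this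
  have hform (v w : Vec q₁ × Vec q₂) : form d v w =
      χ₁ (det2 w.1.toAdd v.1.toAdd) * χ₂ (det2 w.2.toAdd v.2.toAdd) := by
    have hsplit (v : Vec q₁ × Vec q₂) : v = (v.1, 1) * (1, v.2) := by simp
    conv_lhs => rw [hsplit v, hsplit w]
    rw [form_mul_left d (Commute.all _ _) (Commute.all _ _),
      form_mul_right d (Commute.all _ _) (Commute.all _ _),
      form_mul_right d (Commute.all _ _) (Commute.all _ _), h₁, h₂, cross,
      form_symm d (Commute.all (w.1, 1) (1, v.2)), cross]
    simp
  let e (q : ℕ) : Vec q := Multiplicative.ofAdd (Pi.single 0 1)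
  have he (q : ℕ) (hq : q.Prime) : e q ≠ 1 := by
    intro h
    have := Fact.mk hq
    have : (1 : ZMod q) = 0 := congrFun (congrArg Multiplicative.toAdd h) 0
    exact one_ne_zero this
  refine ⟨χ₁, χ₂, AddChar.IsPrimitive.of_ne_one ?_, AddChar.IsPrimitive.of_ne_one ?_, hform⟩
  · rintro rfl
    obtain ⟨w, -, hw⟩ := (nondeg_iff d).1 hd (e q₁, 1) fun h => he q₁ hq₁ (congrArg Prod.fst h)
    exact hw (by rw [hform]; simp [det2])
  · rintro rfl
    obtain ⟨w, -, hw⟩ := (nondeg_iff d).1 hd (1, e q₂) fun h => he q₂ hq₂ (congrArg Prod.snd h)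
    exact hw (by rw [hform]; simp [det2])

end VecProd

section ATypeProduct

variable {q₁ q₂ k : ℕ} {η₁ : CC k →* SpecialLinearGroup (Fin 2) (ZMod q₁)}
  {η₂ : CC k →* SpecialLinearGroup (Fin 2) (ZMod q₂)}

/-- The projection of `G₁ × G₂` to the complement `(C_k × C_k) × (C_k × C_k)`. -/
def prodProj (η₁ : CC k →* SpecialLinearGroup (Fin 2) (ZMod q₁))
    (η₂ : CC k →* SpecialLinearGroup (Fin 2) (ZMod q₂)) :
    SLProd η₁ × SLProd η₂ →* CC k × CC k :=
  MonoidHom.prodMap SemidirectProduct.rightHom SemidirectProduct.rightHom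

/-- The inclusion of the complement `(C_k × C_k) × (C_k × C_k)` in `G₁ × G₂`. -/
def prodSec (η₁ : CC k →* SpecialLinearGroup (Fin 2) (ZMod q₁))
    (η₂ : CC k →* SpecialLinearGroup (Fin 2) (ZMod q₂)) :
    CC k × CC k →* SLProd η₁ × SLProd η₂ :=
  MonoidHom.prodMap SemidirectProduct.inr SemidirectProduct.inr

/-- The inclusion of `(ℤ/q₁)² × (ℤ/q₂)²` in `G₁ × G₂`. -/
def prodVec (η₁ : CC k →* SpecialLinearGroup (Fin 2) (ZMod q₁))
    (η₂ : CC k →* SpecialLinearGroup (Fin 2) (ZMod q₂)) :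
    Vec q₁ × Vec q₂ →* SLProd η₁ × SLProd η₂ :=
  MonoidHom.prodMap SemidirectProduct.inl SemidirectProduct.inl

theorem eq_prodVec_of_proj_eq_one {g : SLProd η₁ × SLProd η₂} (hg : prodProj η₁ η₂ g = 1) :
    g = prodVec η₁ η₂ (g.1.left, g.2.left) := by
  have h1 : g.1.right = 1 := congrArg Prod.fst hg
  have h2 : g.2.right = 1 := congrArg Prod.snd hg
  exact Prod.ext (SemidirectProduct.ext rfl h1) (SemidirectProduct.ext rfl h2)

theorem prodProj_sec (q : CC k × CC k) : prodProj η₁ η₂ (prodSec η₁ η₂ q) = q :=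
  rfl

theorem exists_squarefree_exponent (hq₁ : q₁.Prime) (hq₂ : q₂.Prime) (hk : k.Prime)
    (hc₁ : k.Coprime q₁) (hc₂ : k.Coprime q₂) :
    ∃ E, q₁ ∣ E ∧ q₂ ∣ E ∧ k.Coprime E ∧ Squarefree (k * E) := by
  by_cases h : q₁ = q₂
  · subst h
    exact ⟨q₁, dvd_rfl, dvd_rfl, hc₁,
      (Nat.squarefree_mul hc₁).2 ⟨hk.squarefree, hq₁.squarefree⟩⟩
  · refine ⟨q₁ * q₂, dvd_mul_right _ _, dvd_mul_left _ _, hc₁.mul_right hc₂,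
      (Nat.squarefree_mul (hc₁.mul_right hc₂)).2 ⟨hk.squarefree, ?_⟩⟩
    exact (Nat.squarefree_mul ((Nat.coprime_primes hq₁ hq₂).2 h)).2
      ⟨hq₁.squarefree, hq₂.squarefree⟩

theorem pow_eq_one_of_proj {E : ℕ} (h₁ : q₁ ∣ E) (h₂ : q₂ ∣ E) {g : SLProd η₁ × SLProd η₂}
    (hg : prodProj η₁ η₂ g = 1) : g ^ E = 1 := by
  rw [eq_prodVec_of_proj_eq_one hg, ← map_pow]
  obtain ⟨a, rfl⟩ := h₁
  obtain ⟨b, hb⟩ := h₂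
  have e1 : (g.1.left : Vec q₁) ^ (q₁ * a) = 1 := by rw [pow_mul, vec_pow_eq_one, one_pow]
  have e2 : (g.2.left : Vec q₂) ^ (q₁ * a) = 1 := by rw [hb, pow_mul, vec_pow_eq_one, one_pow]
  rw [Prod.pow_mk, e1, e2]
  exact map_one _

theorem prod_cc_pow (q : CC k × CC k) : q ^ k = 1 :=
  Prod.ext (cc_pow_eq_one _) (cc_pow_eq_one _)

theorem sylow_prod_comm (hq₁ : q₁.Prime) (hq₂ : q₂.Prime) (hk : k.Prime)
    (hc₁ : k.Coprime q₁) (hc₂ : k.Coprime q₂) {r : ℕ} (hr : r.Prime)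
    (P : Sylow r (SLProd η₁ × SLProd η₂)) (a b : SLProd η₁ × SLProd η₂) (ha : a ∈ P)
    (hb : b ∈ P) : a * b = b * a := by
  obtain ⟨E, h₁, h₂, hkE, -⟩ := exists_squarefree_exponent hq₁ hq₂ hk hc₁ hc₂
  refine sylow_comm (prodProj η₁ η₂) hk hr hkE prod_cc_pow (fun g h hg hh => ?_)
    (fun g hg => pow_eq_one_of_proj h₁ h₂ hg) P a b ha hb
  rw [eq_prodVec_of_proj_eq_one hg, eq_prodVec_of_proj_eq_one hh, ← map_mul, ← map_mul, mul_comm]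

theorem sylow_prod_autTransitive [NeZero q₁] [NeZero q₂] [NeZero k] (hq₁ : q₁.Prime)
    (hq₂ : q₂.Prime) (hk : k.Prime) (hc₁ : k.Coprime q₁) (hc₂ : k.Coprime q₂) {r : ℕ}
    (hr : r.Prime) (P : Sylow r (SLProd η₁ × SLProd η₂)) : AutTransitive P := by
  obtain ⟨E, h₁, h₂, hkE, hsq⟩ := exists_squarefree_exponent hq₁ hq₂ hk hc₁ hc₂
  refine autTransitive_of_elementary hr (fun a b => Subtype.ext
    (sylow_prod_comm hq₁ hq₂ hk hc₁ hc₂ hr P a b a.2 b.2)) fun g => ?_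
  obtain ⟨i, hi⟩ := P.isPGroup' g
  refine Subtype.ext (pow_eq_one_of_squarefree hr hsq ?_ (congrArg Subtype.val hi))
  rw [pow_mul]
  refine pow_eq_one_of_proj h₁ h₂ ?_
  rw [map_pow, prod_cc_pow]

variable [NeZero q₁] [NeZero q₂] [NeZero k]

/-- The class of the vector part of `G₁ × G₂`. -/
noncomputable def prodVecClass (η₁ : CC k →* SpecialLinearGroup (Fin 2) (ZMod q₁))
    (η₂ : CC k →* SpecialLinearGroup (Fin 2) (ZMod q₂)) (χ₁ : AddChar (ZMod q₁) ℂˣ)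
    (χ₂ : AddChar (ZMod q₂) ℂˣ) : H2C (SLProd η₁ × SLProd η₂) :=
  pull (MonoidHom.fst _ _) (cls (vecZ2 η₁ χ₁)) + pull (MonoidHom.snd _ _) (cls (vecZ2 η₂ χ₂))

theorem isTransverse_prodVecClass (hc₁ : k.Coprime q₁) (hc₂ : k.Coprime q₂)
    {χ₁ : AddChar (ZMod q₁) ℂˣ} {χ₂ : AddChar (ZMod q₂) ℂˣ} (h₁ : χ₁.IsPrimitive)
    (h₂ : χ₂.IsPrimitive) :
    IsTransverse (prodProj η₁ η₂) (prodSec η₁ η₂) (prodVecClass η₁ η₂ χ₁ χ₂) :=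
  (isTransverse_vecZ2 η₁ hc₁ χ₁ h₁).prod (isTransverse_vecZ2 η₂ hc₂ χ₂ h₂)

omit [NeZero q₁] [NeZero q₂] in
theorem form_pull_prodVecClass (hc₁ : k.Coprime q₁) (hc₂ : k.Coprime q₂)
    (χ₁ : AddChar (ZMod q₁) ℂˣ) (χ₂ : AddChar (ZMod q₂) ℂˣ) (b : H2C (CC k × CC k))
    (v w : Vec q₁ × Vec q₂) :
    form (pull (prodVec η₁ η₂) (prodVecClass η₁ η₂ χ₁ χ₂ + pull (prodProj η₁ η₂) b)) v w =
      χ₁ (det2 w.1.toAdd v.1.toAdd) * χ₂ (det2 w.2.toAdd v.2.toAdd) := by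
  have hvw : Commute v w := Commute.all v w
  have hc : Commute (prodVec η₁ η₂ v) (prodVec η₁ η₂ w) := hvw.map _
  have hp : prodProj η₁ η₂ (prodVec η₁ η₂ v) = 1 := rfl
  rw [form_pull _ _ hvw, form_add _ _ hc, form_pull _ _ hc, hp, form_one_left, mul_one,
    prodVecClass, form_add _ _ hc, form_pull _ _ hc, form_pull _ _ hc]
  congr 1
  · exact form_vecZ2_inl η₁ hc₁ χ₁ (w := w.1.toAdd) (vact_one η₁ _)
  · exact form_vecZ2_inl η₂ hc₂ χ₂ (w := w.2.toAdd) (vact_one η₂ _)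

theorem form_prodSec (hc₁ : k.Coprime q₁) (hc₂ : k.Coprime q₂)
    {χ₁ : AddChar (ZMod q₁) ℂˣ} {χ₂ : AddChar (ZMod q₂) ℂˣ} (h₁ : χ₁.IsPrimitive)
    (h₂ : χ₂.IsPrimitive) (b : H2C (CC k × CC k)) (q q' : CC k × CC k) :
    form (prodVecClass η₁ η₂ χ₁ χ₂ + pull (prodProj η₁ η₂) b) (prodSec η₁ η₂ q)
      (prodSec η₁ η₂ q') = form b q q' := by
  have hq : Commute q q' := Commute.all q q'
  have hc : Commute (prodSec η₁ η₂ q) (prodSec η₁ η₂ q') := hq.map _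
  rw [form_add _ _ hc, form_pull _ _ hc, prodProj_sec, prodProj_sec,
    (isTransverse_prodVecClass hc₁ hc₂ h₁ h₂).form_section q q' hq, one_mul]

end ATypeProduct

section ATypeCase

theorem coprime_of_modEq_one {q k : ℕ} (h : q ≡ 1 [MOD k]) : k.Coprime q := by
  have := h.gcd_eq
  rw [Nat.gcd_one_left] at this
  exact Nat.coprime_comm.1 this

theorem mem_center_prod_iff {G H : Type} [Group G] [Group H] (g : G × H) :
    g ∈ Subgroup.center (G × H) ↔ g.1 ∈ Subgroup.center G ∧ g.2 ∈ Subgroup.center H := by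
  simp only [Subgroup.mem_center_iff]
  exact ⟨fun h => ⟨fun a => congrArg Prod.fst (h (a, 1)), fun b => congrArg Prod.snd (h (1, b))⟩,
    fun h a => Prod.ext (h.1 a.1) (h.2 a.2)⟩

theorem aType_case (q₁ q₂ q₃ : ℕ) (m₁ n₁ m₂ n₂ : ℤ) (hq₁ : q₁.Prime) (hq₂ : q₂.Prime)
    (hq₃ : q₃.Prime) (hmod₁ : q₁ ≡ 1 [MOD q₃]) (hmod₂ : q₂ ≡ 1 [MOD q₃])
    (hmn₁ : m₁ * n₁ ≡ 1 [ZMOD q₁]) (hm₁ : m₁ ^ q₃ ≡ 1 [ZMOD q₁]) (hne₁ : ¬ m₁ ≡ 1 [ZMOD q₁])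
    (hmn₂ : m₂ * n₂ ≡ 1 [ZMOD q₂]) (hm₂ : m₂ ^ q₃ ≡ 1 [ZMOD q₂]) (hne₂ : ¬ m₂ ≡ 1 [ZMOD q₂]) :
    (∃ η₁, IsDiagAction q₁ q₃ m₁ n₁ η₁) ∧ (∃ η₂, IsDiagAction q₂ q₃ m₂ n₂ η₂) ∧
      ∀ η₁ η₂, IsDiagAction q₁ q₃ m₁ n₁ η₁ → IsDiagAction q₂ q₃ m₂ n₂ η₂ →
        let G := SLProd η₁ × SLProd η₂
        let σ₁ : G := (SemidirectProduct.inr (CC.x q₃), 1)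
        let τ₁ : G := (SemidirectProduct.inr (CC.y q₃), 1)
        let σ₂ : G := (1, SemidirectProduct.inr (CC.x q₃))
        let τ₂ : G := (1, SemidirectProduct.inr (CC.y q₃))
        IsAType G ∧ IsCentralType (SLProd η₁) ∧ IsCentralType (SLProd η₂) ∧ IsCentralType G ∧
        (∀ r : ℕ, r.Prime → ∀ P : Sylow r G, AutTransitive P) ∧
        Subgroup.center G = Subgroup.closure {τ₁, τ₂} ∧
        ¬ AutTransitive G ∧
        ∀ ξ : ℂˣ, IsPrimitiveRoot ξ q₃ →
        let ι : Vec q₁ × Vec q₂ →* G :=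
          MonoidHom.prodMap SemidirectProduct.inl SemidirectProduct.inl
        let P : H2C (Vec q₁ × Vec q₂) → Prop := fun d => ∃ c₁ c₂ : H2C G,
          pull ι c₁ = d ∧ pull ι c₂ = d ∧ Nondeg c₁ ∧ Nondeg c₂ ∧
          (form c₁ τ₁ σ₁ = ξ ∧ form c₁ τ₂ σ₂ = ξ ∧ form c₁ τ₁ σ₂ = 1 ∧ form c₁ τ₂ σ₁ = 1 ∧
            form c₁ τ₁ τ₂ = 1 ∧ form c₁ σ₁ σ₂ = 1) ∧
          (form c₂ τ₁ τ₂ = ξ ∧ form c₂ σ₁ σ₂ = ξ ∧ form c₂ τ₁ σ₁ = 1 ∧ form c₂ τ₁ σ₂ = 1 ∧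
            form c₂ τ₂ σ₁ = 1 ∧ form c₂ τ₂ σ₂ = 1) ∧
          ¬ SameOrbit c₁ c₂;
        (∃ d, Nondeg d ∧ P d) ∧ (q₁ ≠ q₂ → ∀ d, Nondeg d → P d) := by
  refine ⟨exists_isDiagAction hq₃ hmn₁ hm₁, exists_isDiagAction hq₃ hmn₂ hm₂,
    fun η₁ η₂ hη₁ hη₂ => ?_⟩
  intro G σ₁ τ₁ σ₂ τ₂
  have := NeZero.mk hq₁.ne_zero
  have := NeZero.mk hq₂.ne_zero
  have := NeZero.mk hq₃.ne_zero
  have hc₁ := coprime_of_modEq_one hmod₁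
  have hc₂ := coprime_of_modEq_one hmod₂
  have hσ₁ : σ₁ = prodSec η₁ η₂ (CC.x q₃, 1) := rfl
  have hτ₁ : τ₁ = prodSec η₁ η₂ (CC.y q₃, 1) := rfl
  have hσ₂ : σ₂ = prodSec η₁ η₂ (1, CC.x q₃) := rfl
  have hτ₂ : τ₂ = prodSec η₁ η₂ (1, CC.y q₃) := rfl
  have hcenter (g : G) : g ∈ Subgroup.center G ↔
      ∃ q : CC q₃ × CC q₃, q.1.1 = 1 ∧ q.2.1 = 1 ∧ g = prodSec η₁ η₂ q := by
    rw [mem_center_prod_iff, hη₁.mem_center_iff hq₁ hq₃ hmn₁ hm₁ hne₁,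
      hη₂.mem_center_iff hq₂ hq₃ hmn₂ hm₂ hne₂]
    constructor
    · rintro ⟨⟨a, ha, hga⟩, ⟨b, hb, hgb⟩⟩
      exact ⟨(a, b), ha, hb, Prod.ext hga hgb⟩
    · rintro ⟨⟨a, b⟩, ha, hb, hg⟩
      exact ⟨⟨a, ha, congrArg Prod.fst hg⟩, ⟨b, hb, congrArg Prod.snd hg⟩⟩
  have hτ₁c : τ₁ ∈ Subgroup.center G := (hcenter _).2 ⟨_, rfl, rfl, hτ₁⟩
  have hτ₂c : τ₂ ∈ Subgroup.center G := (hcenter _).2 ⟨_, rfl, rfl, hτ₂⟩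
  -- The two extensions of a class on the vectors with a given orthogonal form.
  have main (ξ : ℂˣ) (hξ : IsPrimitiveRoot ξ q₃) (χ₁ : AddChar (ZMod q₁) ℂˣ)
      (χ₂ : AddChar (ZMod q₂) ℂˣ) (h₁ : χ₁.IsPrimitive) (h₂ : χ₂.IsPrimitive)
      (d : H2C (Vec q₁ × Vec q₂)) (hd : ∀ v w, form d v w =
        χ₁ (det2 w.1.toAdd v.1.toAdd) * χ₂ (det2 w.2.toAdd v.2.toAdd)) :
      ∃ c₁ c₂ : H2C G,
          pull (prodVec η₁ η₂) c₁ = d ∧ pull (prodVec η₁ η₂) c₂ = d ∧ Nondeg c₁ ∧ Nondeg c₂ ∧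
          (form c₁ τ₁ σ₁ = ξ ∧ form c₁ τ₂ σ₂ = ξ ∧ form c₁ τ₁ σ₂ = 1 ∧ form c₁ τ₂ σ₁ = 1 ∧
            form c₁ τ₁ τ₂ = 1 ∧ form c₁ σ₁ σ₂ = 1) ∧
          (form c₂ τ₁ τ₂ = ξ ∧ form c₂ σ₁ σ₂ = ξ ∧ form c₂ τ₁ σ₁ = 1 ∧ form c₂ τ₁ σ₂ = 1 ∧
            form c₂ τ₂ σ₁ = 1 ∧ form c₂ τ₂ σ₂ = 1) ∧
          ¬ SameOrbit c₁ c₂ := by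
    have hψ := zmodChar_eq_one_iff hξ
    have hψ1 := zmodChar_one hξ.pow_eq_one
    set ψ := AddChar.zmodChar q₃ hξ.pow_eq_one
    have hsec := form_prodSec (η₁ := η₁) (η₂ := η₂) hc₁ hc₂ h₁ h₂
    have htr := isTransverse_prodVecClass (η₁ := η₁) (η₂ := η₂) hc₁ hc₂ h₁ h₂
    refine ⟨prodVecClass η₁ η₂ χ₁ χ₂ + pull (prodProj η₁ η₂) (splitClass ψ),
      prodVecClass η₁ η₂ χ₁ χ₂ + pull (prodProj η₁ η₂) (crossClass ψ),
      eq_of_form_eq mul_comm _ _ fun v w => ?_, eq_of_form_eq mul_comm _ _ fun v w => ?_,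
      htr.nondeg (nondeg_splitClass hψ), htr.nondeg (nondeg_crossClass hψ), ?_, ?_, ?_⟩
    · rw [form_pull_prodVecClass hc₁ hc₂, hd]
    · rw [form_pull_prodVecClass hc₁ hc₂, hd]
    · rw [hσ₁, hσ₂, hτ₁, hτ₂]
      simp only [hsec, form_splitClass]
      simp [CC.x, CC.y, hψ1]
    · rw [hσ₁, hσ₂, hτ₁, hτ₂]
      simp only [hsec, form_crossClass]
      simp [CC.x, CC.y, hψ1]
    · -- The centre is isotropic for the first class and not for the second.
      rintro ⟨φ, hφ⟩
      have hcomm : Commute τ₁ τ₂ := (Subgroup.mem_center_iff.1 hτ₂c τ₁)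
      have h3 := congrArg (fun c => form c τ₁ τ₂) hφ
      simp only [autAct] at h3
      rw [form_pull _ _ hcomm] at h3
      have hchar (z : G) (hz : z ∈ Subgroup.center G) : (φ⁻¹ : MulAut G) z ∈ Subgroup.center G := by
        rw [Subgroup.mem_center_iff] at hz ⊢
        intro g
        have := congrArg (φ⁻¹ : MulAut G) (hz (φ g))
        simpa using this
      obtain ⟨a, ha1, ha2, ha⟩ := (hcenter _).1 (hchar _ hτ₁c)
      obtain ⟨b, hb1, hb2, hb⟩ := (hcenter _).1 (hchar _ hτ₂c)
      have ha' : (φ⁻¹ : MulAut G).toMonoidHom τ₁ = prodSec η₁ η₂ a := ha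
      have hb' : (φ⁻¹ : MulAut G).toMonoidHom τ₂ = prodSec η₁ η₂ b := hb
      rw [ha', hb', hτ₁, hτ₂, hsec, hsec, form_splitClass, form_crossClass, ha1, ha2, hb1, hb2]
        at h3
      simp [CC.y, hψ1] at h3
      exact hξ.ne_one hq₃.one_lt h3.symm
  obtain ⟨χ₁, h₁⟩ := exists_isPrimitive_addChar q₁
  obtain ⟨χ₂, h₂⟩ := exists_isPrimitive_addChar q₂
  have hd₀ := form_pull_prodVecClass (η₁ := η₁) (η₂ := η₂) hc₁ hc₂ χ₁ χ₂ 0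
  obtain ⟨ξ₀, hξ₀⟩ := exists_isPrimitiveRoot_units q₃ hq₃.ne_zero
  obtain ⟨c₁, c₂, -, -, hn₁, hn₂, -, -, horb⟩ := main ξ₀ hξ₀ χ₁ χ₂ h₁ h₂ _ hd₀
  refine ⟨fun r hr P a ha b hb => sylow_prod_comm hq₁ hq₂ hq₃ hc₁ hc₂ hr P a b ha hb, ?_, ?_,
    ⟨c₁, hn₁⟩, fun r hr P => sylow_prod_autTransitive hq₁ hq₂ hq₃ hc₁ hc₂ hr P, ?_,
    fun h => horb (h c₁ c₂ hn₁ hn₂), fun ξ hξ => ⟨⟨_, nondeg_of_form_det2 h₁ h₂ hd₀,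
      main ξ hξ χ₁ χ₂ h₁ h₂ _ hd₀⟩, fun hne d hd => ?_⟩⟩
  · obtain ⟨c, hc, -⟩ := exists_nondeg_slprod hc₁ η₁ hξ₀
    exact ⟨c, hc⟩
  · obtain ⟨c, hc, -⟩ := exists_nondeg_slprod hc₂ η₂ hξ₀
    exact ⟨c, hc⟩
  · refine le_antisymm (fun g hg => ?_) ?_
    · obtain ⟨q, hq1, hq2, rfl⟩ := (hcenter g).1 hg
      have : prodSec η₁ η₂ q = τ₁ ^ q.1.2.toAdd.val * τ₂ ^ q.2.2.toAdd.val := by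
        rw [hτ₁, hτ₂, ← map_pow, ← map_pow, ← map_mul]
        congr 1
        refine Prod.ext ?_ ?_
        · conv_lhs => rw [cc_eq_mul q.1, hq1]
          simp
        · conv_lhs => rw [cc_eq_mul q.2, hq2]
          simp
      rw [this]
      exact Subgroup.mul_mem _ (Subgroup.pow_mem _ (Subgroup.subset_closure (by simp)) _)
        (Subgroup.pow_mem _ (Subgroup.subset_closure (by simp)) _)
    · rw [Subgroup.closure_le]
      rintro g (rfl | rfl)
      · exact hτ₁c
      · exact hτ₂c
  · obtain ⟨χ₁, χ₂, h₁, h₂, hform⟩ := exists_form_eq_of_nondeg hq₁ hq₂ hne hd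
    exact main ξ hξ χ₁ χ₂ h₁ h₂ d hform

end ATypeCase

/-! ### The group of order 256 -/

section Order256

theorem pi₀_bijective : Function.Bijective pi₀ := by decide

theorem pi₀_mul : ∀ q r : Q4, pi₀ (q * r) = pi₀ q * act₀ q (pi₀ r) := by decide

theorem piC_bijective : Function.Bijective piC := pi₀_bijective.prodMap pi₀_bijective

theorem piC_mul (q r : Q16) : piC (q * r) = piC q * act q (piC r) :=
  Prod.ext (pi₀_mul q.1 r.1) (pi₀_mul q.2 r.2)

theorem a16_mul_self : ∀ a : A16, a * a = 1 := by
  have h : ∀ a : V4, a * a = 1 := by decide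
  exact fun a => Prod.ext (h a.1) (h a.2)

theorem charAct_act (q : Q16) (χ : A16char) (a : A16) : charAct q χ (act q a) = χ a := by
  show χ (act q⁻¹ (act q a)) = χ a
  rw [← MulAut.mul_apply, ← map_mul, inv_mul_cancel, map_one, MulAut.one_apply]

theorem charAct_piC_mul (q r : Q16) (χ : A16char) :
    charAct q χ (piC (q * r)) = charAct q χ (piC q) * χ (piC r) := by
  rw [piC_mul, map_mul, charAct_act]

/-- The cocycle `c_π` of `G = Hom(A, ℂˣ) ⋊ Q`. -/
noncomputable def cπZ2 : Z2C G256 :=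
  mkZ2 (fun g h => (charAct g.right h.left) (piC g.right)) fun a b c => by
    have h1 : charAct (a.right * b.right) c.left = charAct a.right (charAct b.right c.left) := by
      rw [map_mul]; rfl
    have h2 : charAct a.right (b.left * charAct b.right c.left) =
      charAct a.right b.left * charAct a.right (charAct b.right c.left) := map_mul _ _ _
    rw [SemidirectProduct.mul_right, SemidirectProduct.mul_left, h1, charAct_piC_mul, h2,
      MonoidHom.mul_apply]
    generalize charAct a.right (charAct b.right c.left) (piC a.right) = x
    generalize charAct b.right c.left (piC b.right) = y
    generalize charAct a.right b.left (piC a.right) = z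
    rw [mul_comm x y, mul_assoc, mul_comm x z]

theorem nat_card_a16char : Nat.card A16char = 16 := by
  have := CommGroup.card_monoidHom_of_hasEnoughRootsOfUnity A16 ℂ
  rw [this]
  simp

instance : Finite A16char := Nat.finite_of_card_ne_zero (by rw [nat_card_a16char]; norm_num)

theorem nat_card_g256 : Nat.card G256 = 256 := by
  rw [SemidirectProduct.card, nat_card_a16char]
  simp

instance : Finite G256 := Nat.finite_of_card_ne_zero (by rw [nat_card_g256]; norm_num)

/-- The projective representation of `G` on functions on `Q`: a character `χ` acts by multiplication
by `χ ∘ π`, and `Q` acts by left translations twisted by the cocycle `c`. -/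
noncomputable def g256Op (c : Z2C Q16) (g : G256) : Module.End ℂ (Q16 → ℂ) :=
  LinearMap.mulLeft ℂ (fun r : Q16 => ((g.left (piC r) : ℂˣ) : ℂ)) ∘ₗ twistedLeft c g.right

theorem g256Op_apply (c : Z2C Q16) (g : G256) (φ : Q16 → ℂ) (r : Q16) :
    g256Op c g φ r = (g.left (piC r) : ℂˣ) * (cval c g.right (g.right⁻¹ * r) * φ (g.right⁻¹ * r)) :=
  rfl

theorem g256Op_mul (c : Z2C Q16) (g h : G256) :
    g256Op c g * g256Op c h =
      (cval (cπZ2 + pullZ SemidirectProduct.rightHom c) g h : ℂ) • g256Op c (g * h) := by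
  refine LinearMap.ext fun φ => funext fun r => ?_
  obtain ⟨s, rfl⟩ : ∃ s, r = g.right * (h.right * s) := ⟨h.right⁻¹ * (g.right⁻¹ * r), by simp⟩
  have hc := congrArg Units.val (cval_mul_cval c g.right h.right s)
  have hπ := congrArg Units.val (charAct_piC_mul g.right (h.right * s) h.left)
  have hsq : ((charAct g.right h.left (piC g.right) : ℂˣ) : ℂ) *
      (charAct g.right h.left (piC g.right) : ℂˣ) = 1 := by
    rw [← Units.val_mul, ← map_mul, a16_mul_self, map_one, Units.val_one]
  show (g256Op c g) (g256Op c h φ) _ = (cval (cπZ2 + pullZ SemidirectProduct.rightHom c) g h : ℂ) *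
    g256Op c (g * h) φ _
  have hcv : (cval (cπZ2 + pullZ SemidirectProduct.rightHom c) g h : ℂ) =
      (charAct g.right h.left (piC g.right) : ℂˣ) * (cval c g.right h.right : ℂ) := rfl
  have hl : (g * h).left = g.left * charAct g.right h.left := rfl
  have hr : (g * h).right = g.right * h.right := rfl
  have hinv : (g.right * h.right)⁻¹ * (g.right * (h.right * s)) = s := by group
  rw [g256Op_apply, g256Op_apply, g256Op_apply, hcv, hl, hr, hinv, MonoidHom.mul_apply]
  simp only [inv_mul_cancel_left, Units.val_mul] at hc hπ ⊢
  rw [hπ]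
  generalize ((g.left (piC (g.right * (h.right * s))) : ℂˣ) : ℂ) = a at *
  generalize ((h.left (piC (h.right * s)) : ℂˣ) : ℂ) = b at *
  generalize ((charAct g.right h.left (piC g.right) : ℂˣ) : ℂ) = e at *
  linear_combination (-(a * b * φ s)) * hc -
    (a * b * φ s * (cval c g.right h.right) * (cval c (g.right * h.right) s)) * hsq

theorem g256Op_linearIndependent (c : Z2C Q16) : LinearIndependent ℂ (g256Op c) := by
  classical
  have := Fintype.ofFinite G256
  have := Fintype.ofFinite A16char
  rw [Fintype.linearIndependent_iff]
  intro a ha g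
  -- The matrix coefficient at `(r, q⁻¹ r)` only sees the elements over `q`.
  have coeff (r : Q16) : ∑ χ : A16char, a ⟨χ, g.right⟩ * (χ (piC r) : ℂˣ) = 0 := by
    have h1 := congrFun (LinearMap.congr_fun ha (Pi.single (g.right⁻¹ * r) 1)) r
    simp only [LinearMap.sum_apply, LinearMap.smul_apply, Finset.sum_apply, Pi.smul_apply,
      LinearMap.zero_apply, Pi.zero_apply, smul_eq_mul, g256Op_apply, Pi.single_apply,
      mul_left_inj, _root_.inv_inj] at h1
    rw [← Equiv.sum_comp SemidirectProduct.equivProd.symm, Fintype.sum_prod_type] at h1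
    simp only [SemidirectProduct.equivProd_symm_apply_left,
      SemidirectProduct.equivProd_symm_apply_right, mul_ite, mul_one, mul_zero,
      Finset.sum_ite_eq', Finset.mem_univ, if_true] at h1
    have h2 : (∑ χ : A16char, a ⟨χ, g.right⟩ * (χ (piC r) : ℂˣ)) *
        (cval c g.right (g.right⁻¹ * r) : ℂ) = 0 := by
      rw [← h1, Finset.sum_mul]
      refine Finset.sum_congr rfl fun χ _ => ?_
      rw [mul_assoc]
      rfl
    exact (mul_eq_zero.1 h2).resolve_right (Units.ne_zero _)
  have ind : LinearIndependent ℂ (fun χ : A16char => fun x : A16 => ((χ x : ℂˣ) : ℂ)) :=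
    (linearIndependent_monoidHom A16 ℂ).comp (fun χ : A16char => (Units.coeHom ℂ).comp χ)
      fun χ ψ h => MonoidHom.ext fun x => Units.ext (DFunLike.congr_fun h x)
  rw [Fintype.linearIndependent_iff] at ind
  refine ind (fun χ => a ⟨χ, g.right⟩) (funext fun x => ?_) g.left
  obtain ⟨r, rfl⟩ := piC_bijective.2 x
  simpa [Finset.sum_apply] using coeff r

/-- Twisting `c_π` by a cocycle inflated from `Q` keeps it non-degenerate. -/
theorem nondeg_cπ_add (c : Z2C Q16) : Nondeg (cls cπZ2 + infQ (cls c)) := by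
  have := Fintype.ofFinite G256
  have hcard : Fintype.card G256 = Module.finrank ℂ (Module.End ℂ (Q16 → ℂ)) := by
    rw [← Nat.card_eq_fintype_card, nat_card_g256, Module.finrank_linearMap]
    simp
  let u := basisOfLinearIndependentOfCardEqFinrank (g256Op_linearIndependent c) hcard
  have hu (g h : G256) : u g * u h =
      (cval (cπZ2 + pullZ SemidirectProduct.rightHom c) g h : ℂ) • u (g * h) := by
    simp only [u, coe_basisOfLinearIndependentOfCardEqFinrank]
    exact g256Op_mul c g h
  rw [infQ, pull_cls_eq, ← cls_add]
  exact (nondeg_iff _).2 fun g hg => exists_form_ne_one_of_central hu hg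

theorem order256_case :
    Nat.card G256 = 256 ∧
      (Function.Bijective piC ∧ ∀ q r : Q16, piC (q * r) = piC q * act q (piC r)) ∧
      IsCentralType G256 ∧
      ¬ AutTransitive G256 ∧
      ∃ (cπ β : H2C G256) (c : H2C Q16),
        IsCπ cπ ∧ resQ cπ = 0 ∧ Nondeg cπ ∧ addOrderOf cπ = 2 ∧
        ((form c (Q4.x, 1) (1, Q4.x) : ℂˣ) : ℂ) = Complex.I ∧ addOrderOf c = 4 ∧
        β = cπ + infQ c ∧ resQ β = c ∧
        Nondeg β ∧ addOrderOf β = 4 := by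
  let ι : ℂˣ := Units.mk0 Complex.I Complex.I_ne_zero
  have hι : ι ^ 4 = 1 := Units.ext Complex.I_pow_four
  let cz : Z2C Q16 := ccZ2 (k := 4) hι
  have hform : form (cls cz) (Q4.x, 1) (1, Q4.x) = ι := by
    refine (form_ccZ2 (k := 4) hι (Q4.x, 1) (1, Q4.x)).trans ?_
    simp [Q4.x, zmodChar_one]
  have hc4 : (4 : ℕ) • cls cz = 0 := by
    have h0 : 4 • cz = 0 := z2_ext fun a b => by
      rw [cval_nsmul, cval_zero]
      show (AddChar.zmodChar 4 hι _) ^ 4 = 1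
      rw [AddChar.zmodChar_apply, pow_right_comm, hι, one_pow]
    rw [← cls_nsmul, h0, cls_zero]
  have hc2 : (2 : ℕ) • cls cz ≠ 0 := by
    intro h
    have hcom : Commute ((Q4.x, 1) : Q16) (1, Q4.x) := Commute.all _ _
    have h1 := form_add (cls cz) (cls cz) hcom
    rw [← two_nsmul, h, form_zero hcom, hform] at h1
    have h2 := congrArg Units.val h1
    have h3 : (1 : ℂ) = Complex.I * Complex.I := h2
    rw [Complex.I_mul_I] at h3
    norm_num at h3
  have hcπ2 : (2 : ℕ) • cls cπZ2 = 0 := by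
    have h0 : 2 • cπZ2 = 0 := z2_ext fun a b => by
      rw [cval_nsmul, cval_zero, sq]
      show charAct _ _ _ * charAct _ _ _ = 1
      rw [← map_mul, a16_mul_self, map_one]
    rw [← cls_nsmul, h0, cls_zero]
  have hres : resQ (cls cπZ2) = 0 := by
    have h0 : pullZ (SemidirectProduct.inr : Q16 →* G256) cπZ2 = 0 := z2_ext fun a b => by
      show charAct a 1 (piC a) = 1
      rw [map_one]
      rfl
    rw [resQ, pull_cls_eq, h0, cls_zero]
  have hinf : resQ (infQ (cls cz)) = cls cz := by
    rw [resQ, infQ, pull_cls_eq, pull_cls_eq]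
    congr 1
  have hresβ : resQ (cls cπZ2 + infQ (cls cz)) = cls cz := by
    rw [map_add, hres, hinf, zero_add]
  have hndπ : Nondeg (cls cπZ2) := by
    have := nondeg_cπ_add 0
    rwa [cls_zero, map_zero, add_zero] at this
  have hne : cls cπZ2 ≠ 0 := by
    intro h0
    have hg : (SemidirectProduct.inr (Q4.x, 1) : G256) ≠ 1 := by
      intro h
      have h1 : Q4.x = 1 := congrArg (fun g : G256 => g.right.1) h
      exact absurd h1 (by decide)
    obtain ⟨h, hc, hh⟩ := (nondeg_iff _).1 hndπ _ hg
    rw [h0, form_zero hc] at hh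
    exact hh rfl
  have hβ4 : (4 : ℕ) • (cls cπZ2 + infQ (cls cz)) = 0 := by
    rw [nsmul_add, ← map_nsmul, hc4, map_zero, add_zero]
    exact (mul_nsmul (cls cπZ2) 2 2).trans (by rw [hcπ2, nsmul_zero])
  have hβ2 : (2 : ℕ) • (cls cπZ2 + infQ (cls cz)) ≠ 0 := by
    intro h
    have := congrArg resQ h
    rw [map_nsmul, hresβ, map_zero] at this
    exact hc2 this
  have : Fact (Nat.Prime 2) := ⟨Nat.prime_two⟩
  refine ⟨nat_card_g256, ⟨piC_bijective, piC_mul⟩, ⟨_, hndπ⟩, fun htrans => ?_, cls cπZ2,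
    cls cπZ2 + infQ (cls cz), cls cz, ⟨cπZ2, rfl, fun _ _ => rfl⟩, hres, hndπ,
    addOrderOf_eq_prime hcπ2 hne, by rw [hform]; rfl,
    addOrderOf_eq_prime_pow (p := 2) (n := 1) hc2 hc4, rfl, hresβ, nondeg_cπ_add cz,
    addOrderOf_eq_prime_pow (p := 2) (n := 1) hβ2 hβ4⟩
  -- Automorphisms preserve the order of a class.
  obtain ⟨φ, hφ⟩ := htrans _ _ hndπ (nondeg_cπ_add cz)
  apply hβ2
  rw [← hφ, ← map_nsmul, hcπ2, map_zero]

end Order256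

end CentralType

theorem mainTheorem8 :
    -- groups of cube-free order
    (∀ (k : ℕ) (p : Fin 3 → ℕ), k.Prime → Odd k → (∀ i, (p i).Prime) → Function.Injective p →
      (∀ i, (p i : ℤ) ≡ 1 [ZMOD k] ∨ (p i : ℤ) ≡ -1 [ZMOD k]) →
      (∃ η, HasKernels p k η) ∧
      ∀ η, HasKernels p k η →
        Nat.card (SLProd η) = ((∏ i, p i) * k) ^ 2 ∧
        (∀ r : ℕ, r.Prime → ¬ r ^ 3 ∣ Nat.card (SLProd η)) ∧
        IsCentralType (SLProd η) ∧
        ¬ AutTransitive (SLProd η) ∧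
        (∀ ξ : ℂˣ, IsPrimitiveRoot ξ k → ∃ c : H2C (SLProd η), Nondeg c ∧
          form c (SemidirectProduct.inr (CC.x k)) (SemidirectProduct.inr (CC.y k)) = ξ) ∧
        (∀ c c' : H2C (SLProd η), SameOrbit c c' → ∃ j : ℕ, 1 ≤ j ∧ j ≤ k - 1 ∧
          form c' (SemidirectProduct.inr (CC.x k)) (SemidirectProduct.inr (CC.y k)) =
            form c (SemidirectProduct.inr (CC.x k)) (SemidirectProduct.inr (CC.y k)) ^ j ^ 2)) ∧
    -- direct products of A-type
    (∀ (q₁ q₂ q₃ : ℕ) (m₁ n₁ m₂ n₂ : ℤ), q₁.Prime → q₂.Prime → q₃.Prime →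
      q₁ ≡ 1 [MOD q₃] → q₂ ≡ 1 [MOD q₃] →
      m₁ * n₁ ≡ 1 [ZMOD q₁] → m₁ ^ q₃ ≡ 1 [ZMOD q₁] → ¬ m₁ ≡ 1 [ZMOD q₁] →
      m₂ * n₂ ≡ 1 [ZMOD q₂] → m₂ ^ q₃ ≡ 1 [ZMOD q₂] → ¬ m₂ ≡ 1 [ZMOD q₂] →
      (∃ η₁, IsDiagAction q₁ q₃ m₁ n₁ η₁) ∧ (∃ η₂, IsDiagAction q₂ q₃ m₂ n₂ η₂) ∧
      ∀ η₁ η₂, IsDiagAction q₁ q₃ m₁ n₁ η₁ → IsDiagAction q₂ q₃ m₂ n₂ η₂ →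
        let G := SLProd η₁ × SLProd η₂
        let σ₁ : G := (SemidirectProduct.inr (CC.x q₃), 1)
        let τ₁ : G := (SemidirectProduct.inr (CC.y q₃), 1)
        let σ₂ : G := (1, SemidirectProduct.inr (CC.x q₃))
        let τ₂ : G := (1, SemidirectProduct.inr (CC.y q₃))
        IsAType G ∧ IsCentralType (SLProd η₁) ∧ IsCentralType (SLProd η₂) ∧ IsCentralType G ∧
        (∀ r : ℕ, r.Prime → ∀ P : Sylow r G, AutTransitive P) ∧
        Subgroup.center G = Subgroup.closure {τ₁, τ₂} ∧
        ¬ AutTransitive G ∧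
        ∀ ξ : ℂˣ, IsPrimitiveRoot ξ q₃ →
        let ι : Vec q₁ × Vec q₂ →* G :=
          MonoidHom.prodMap SemidirectProduct.inl SemidirectProduct.inl
        let P : H2C (Vec q₁ × Vec q₂) → Prop := fun d => ∃ c₁ c₂ : H2C G,
          pull ι c₁ = d ∧ pull ι c₂ = d ∧ Nondeg c₁ ∧ Nondeg c₂ ∧
          (form c₁ τ₁ σ₁ = ξ ∧ form c₁ τ₂ σ₂ = ξ ∧ form c₁ τ₁ σ₂ = 1 ∧ form c₁ τ₂ σ₁ = 1 ∧
            form c₁ τ₁ τ₂ = 1 ∧ form c₁ σ₁ σ₂ = 1) ∧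
          (form c₂ τ₁ τ₂ = ξ ∧ form c₂ σ₁ σ₂ = ξ ∧ form c₂ τ₁ σ₁ = 1 ∧ form c₂ τ₁ σ₂ = 1 ∧
            form c₂ τ₂ σ₁ = 1 ∧ form c₂ τ₂ σ₂ = 1) ∧
          ¬ SameOrbit c₁ c₂;
        (∃ d, Nondeg d ∧ P d) ∧ (q₁ ≠ q₂ → ∀ d, Nondeg d → P d)) ∧
    -- a group of order 256
    (Nat.card G256 = 256 ∧
      (Function.Bijective piC ∧ ∀ q r : Q16, piC (q * r) = piC q * act q (piC r)) ∧
      IsCentralType G256 ∧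
      ¬ AutTransitive G256 ∧
      ∃ (cπ β : H2C G256) (c : H2C Q16),
        IsCπ cπ ∧ resQ cπ = 0 ∧ Nondeg cπ ∧ addOrderOf cπ = 2 ∧
        ((form c (Q4.x, 1) (1, Q4.x) : ℂˣ) : ℂ) = Complex.I ∧ addOrderOf c = 4 ∧
        β = cπ + infQ c ∧ resQ β = c ∧
        Nondeg β ∧ addOrderOf β = 4) :=
  ⟨fun k p hk hodd hp hinj hpk => cubeFree_case k p hk hodd hp hinj hpk,
    fun q₁ q₂ q₃ m₁ n₁ m₂ n₂ hq₁ hq₂ hq₃ hmod₁ hmod₂ hmn₁ hm₁ hne₁ hmn₂ hm₂ hne₂ =>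
      aType_case q₁ q₂ q₃ m₁ n₁ m₂ n₂ hq₁ hq₂ hq₃ hmod₁ hmod₂ hmn₁ hm₁ hne₁ hmn₂ hm₂ hne₂,
    order256_case⟩
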